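/- Let $n\ge 2$ and let $H_0,H_1$ be Hermitian $n\times n$ matrices. Assume the Hamiltonian is \emph{ideal}: in an orthonormal eigenbasis of $H_0$, in which $H_0=\operatorname{diag}(a_1,\dots,a_n)$, the transition frequencies $\omega_{k\ell}=a_\ell-a_k$ ($k\ne\ell$) are pairwise distinct ($H_0$ is strongly regular) and all off-diagonal entries $b_{k\ell}$ ($k\neq\ell$) of $H_1$ are nonzero ($H_1$ is fully connected). Let $\rho_d$ be a density matrix (positive semidefinite, trace one) that is generic ($n$ distinct eigenvalues) and stationary ($[H_0,\rho_d]=0$). Let $\mathcal M$ be the manifold of all density matrices with the same spectrum as $\rho_d$, put $V(\rho)=\frac12\|\rho-\rho_d\|^2$ with the Hilbert--Schmidt norm, and consider on $\mathcal M$ the closed-loop system $$\dot\rho=-i\,[H_0+f(\rho)H_1,\rho],\qquad f(\rho)=\operatorname{Tr}\big([-iH_1,\rho]\,\rho_d\big).$$ For a stationary state $\rho_0\in\mathcal M$ let $S_{\mathcal T}=\{-i[K,\rho_0] : K=K^\dagger\}$ be the tangent space of $\mathcal M$ at $\rho_0$, and let $D_f(\rho_0)$ be the linearization (the real derivative at $\rho_0$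 of the vector field on the right-hand side). Then: (a) The system has exactly $n!$ stationary states in $\mathcal M$, and each is hyperbolic: $D_f(\rho_0)$ maps $S_{\mathcal T}$ into itself, and its restriction to $S_{\mathcal T}$ has no complex eigenvalue with zero real part. (b) $\rho_d$ is a stationary state and it is the only sink, i.e. the only stationary state at which all eigenvalues of the restricted linearization have negative real part. (c) $V$ attains its maximum over $\mathcal M$ at exactly one point; this point is a stationary state different from $\rho_d$, and it is a source: all eigenvalues of the restricted linearization have positive real part. (d) The remaining $n!-2$ stationary states are saddles: they are hyperbolic, and the restricted linearization has both an eigenvalue with negative real part and one with positive real part. -/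

import Mathlib

open scoped Nat Matrix ComplexOrder

/-- Complex `n × n` matrices: the operators on the Hilbert space `ℂⁿ`. -/
abbrev CMat (n : ℕ) : Type := Matrix (Fin n) (Fin n) ℂ

-- The Hilbert-Schmidt (Frobenius) norm; it is only used to speak of Fréchet derivatives.
attribute [local instance] Matrix.frobeniusNormedAddCommGroup Matrix.frobeniusNormedSpace

namespace LyapunovControl

/-- Density operators: positive semidefinite Hermitian matrices of trace one. -/
def IsDensity {n : ℕ} (ρ : CMat n) : Prop :=
  ρ.PosSemidef ∧ ρ.trace = 1

/-- A state is generic if it has `n` distinct eigenvalues. -/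
def IsGeneric {n : ℕ} (ρ : CMat n) : Prop :=
  (spectrum ℂ ρ).ncard = n

/-- Strong regularity of energy levels `a`: the transition frequencies `ω k l = a l - a k`,
`k ≠ l`, are pairwise distinct. -/
def StronglyRegular {n : ℕ} (a : Fin n → ℝ) : Prop :=
  ∀ k l p q : Fin n, k ≠ l → p ≠ q → a l - a k = a q - a p → k = p ∧ l = q

/-- Full connectedness: all off-diagonal entries are nonzero. -/
def FullyConnected {n : ℕ} (B : CMat n) : Prop :=
  ∀ k l : Fin n, k ≠ l → B k l ≠ 0

/-- `(H₀, H₁)` is ideal: in an orthonormal eigenbasis of `H₀` (the columns of `U`), in which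
`H₀ = diag(a)`, the levels `a` are strongly regular and the matrix of `H₁` is fully connected. -/
def IsIdeal {n : ℕ} (H₀ H₁ : CMat n) : Prop :=
  ∃ U ∈ Matrix.unitaryGroup (Fin n) ℂ, ∃ a : Fin n → ℝ,
    H₀ = U * Matrix.diagonal (fun k => (a k : ℂ)) * Uᴴ ∧
    StronglyRegular a ∧ FullyConnected (Uᴴ * H₁ * U)

/-- The manifold of density operators isospectral with `ρd` (eigenvalues with multiplicity). -/
def stateManifold {n : ℕ} (ρd : CMat n) : Set (CMat n) :=
  {ρ | IsDensity ρ ∧ ρ.charpoly = ρd.charpoly}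

/-- The feedback `f(ρ) = Tr([-i H₁, ρ] ρd)`; it is real when `H₁`, `ρ`, `ρd` are Hermitian. -/
noncomputable def feedback {n : ℕ} (H₁ ρd ρ : CMat n) : ℂ :=
  (⁅(-Complex.I) • H₁, ρ⁆ * ρd).trace

/-- The closed-loop vector field `ρ ↦ -i [H₀ + f(ρ) H₁, ρ]`. -/
noncomputable def vectorField {n : ℕ} (H₀ H₁ ρd ρ : CMat n) : CMat n :=
  (-Complex.I) • ⁅H₀ + feedback H₁ ρd ρ • H₁, ρ⁆

/-- The stationary states of the closed-loop system on the state manifold. -/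
def stationaryStates {n : ℕ} (H₀ H₁ ρd : CMat n) : Set (CMat n) :=
  {ρ | ρ ∈ stateManifold ρd ∧ vectorField H₀ H₁ ρd ρ = 0}

/-- The Lyapunov function `V(ρ) = ½ ‖ρ - ρd‖²`, with the Hilbert-Schmidt norm
`‖A‖² = Tr(A† A)`. -/
noncomputable def lyapunov {n : ℕ} (ρd ρ : CMat n) : ℝ :=
  1 / 2 * ((ρ - ρd)ᴴ * (ρ - ρd)).trace.re

/-- The tangent space at `ρ` of the manifold of matrices unitarily equivalent to the Hermitian
matrix `ρ`: the real space of all `-i [K, ρ]`, `K` Hermitian. -/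
def tangentSpace {n : ℕ} (ρ : CMat n) : Submodule ℝ (CMat n) where
  carrier := {X | ∃ K : CMat n, K.IsHermitian ∧ X = (-Complex.I) • ⁅K, ρ⁆}
  zero_mem' := ⟨0, Matrix.isHermitian_zero, by simp [Ring.lie_def]⟩
  add_mem' := by
    rintro _ _ ⟨K, hK, rfl⟩ ⟨L, hL, rfl⟩
    exact ⟨K + L, hK.add hL, by
      rw [← smul_add]
      congr 1
      simp only [Ring.lie_def]
      noncomm_ring⟩
  smul_mem' := by
    rintro c _ ⟨K, hK, rfl⟩
    refine ⟨c • K, ?_, ?_⟩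
    · ext i j
      have h := hK.apply i j
      simp only [Matrix.conjTranspose_apply, Matrix.smul_apply, Complex.real_smul, star_mul',
        RCLike.star_def, Complex.conj_ofReal] at h ⊢
      rw [h]
    · ext i j
      simp [Ring.lie_def, mul_sub]
      ring

/-- The linearization at `ρ`: the real Fréchet derivative of the closed-loop vector field. -/
noncomputable def linearization {n : ℕ} (H₀ H₁ ρd ρ : CMat n) : CMat n →ₗ[ℝ] CMat n :=
  (fderiv ℝ (vectorField H₀ H₁ ρd) ρ : CMat n →L[ℝ] CMat n)

/-- The linear map `D` leaves `T` invariant. -/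
def LeavesInvariant {W : Type*} [AddCommGroup W] [Module ℝ W]
    (D : W →ₗ[ℝ] W) (T : Submodule ℝ W) : Prop :=
  ∀ x ∈ T, D x ∈ T

/-- `z` is a (complex) eigenvalue of the restriction of `D` to the invariant subspace `T`. -/
def IsRestrictedEigenvalue {W : Type*} [AddCommGroup W] [Module ℝ W]
    (D : W →ₗ[ℝ] W) (T : Submodule ℝ W) (hT : LeavesInvariant D T) (z : ℂ) : Prop :=
  Module.End.HasEigenvalue ((D.restrict hT).baseChange ℂ) z

/-- Hyperbolic point: the linearization restricts to the tangent space, and this restriction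
has no eigenvalue with zero real part. -/
def IsHyperbolic {n : ℕ} (H₀ H₁ ρd ρ : CMat n) : Prop :=
  ∃ hT : LeavesInvariant (linearization H₀ H₁ ρd ρ) (tangentSpace ρ),
    ∀ z, IsRestrictedEigenvalue _ _ hT z → z.re ≠ 0

/-- Sink: all eigenvalues of the restricted linearization have negative real part. -/
def IsSink {n : ℕ} (H₀ H₁ ρd ρ : CMat n) : Prop :=
  ∃ hT : LeavesInvariant (linearization H₀ H₁ ρd ρ) (tangentSpace ρ),
    ∀ z, IsRestrictedEigenvalue _ _ hT z → z.re < 0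

/-- Source: all eigenvalues of the restricted linearization have positive real part. -/
def IsSource {n : ℕ} (H₀ H₁ ρd ρ : CMat n) : Prop :=
  ∃ hT : LeavesInvariant (linearization H₀ H₁ ρd ρ) (tangentSpace ρ),
    ∀ z, IsRestrictedEigenvalue _ _ hT z → 0 < z.re

/-- Saddle: hyperbolic, with eigenvalues of negative and of positive real part. -/
def IsSaddle {n : ℕ} (H₀ H₁ ρd ρ : CMat n) : Prop :=
  ∃ hT : LeavesInvariant (linearization H₀ H₁ ρd ρ) (tangentSpace ρ),
    (∀ z, IsRestrictedEigenvalue _ _ hT z → z.re ≠ 0) ∧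
    (∃ z, IsRestrictedEigenvalue _ _ hT z ∧ z.re < 0) ∧
    (∃ z, IsRestrictedEigenvalue _ _ hT z ∧ 0 < z.re)

end LyapunovControl

/-! In an eigenbasis of `H₀` the state `ρd` is `diag(w)` with `w` injective. Pairing the
stationarity equation with `ρd` gives `f(ρ)² = 0`, so a stationary state commutes with `H₀` and is
`diag(w ∘ σ)` for a unique permutation `σ`.

At such a point `f` vanishes, so on the off-diagonal positions the linearization is `i` times the
diagonal matrix of transition frequencies `ω` plus a rank-one term. Its eigenvalues are the zeros of
the secular function `1 + ∑ d_j / (z - i ω_j)`, where `d` at `(k, l)` is `|b_kl|² (v_l - v_k)(w_l -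
w_k)` with `v = w ∘ σ`. Taking real parts excludes zeros on the imaginary axis and confines them to
one side when all `d_j` have one sign. Conversely, `exists_secular_eq_zero_re_pos` turns a single
negative `d_j` into a zero with positive real part, by comparing the function with its reflection in
the imaginary axis. Hence the signs of `d` decide the type: all are positive only for `σ = 1`, all
are negative only for the order-reversing `σ`, and mixed signs give saddles.

On the manifold `V` is a constant minus the overlap `Tr(ρd ρ)`. Birkhoff's theorem and the
rearrangement inequality with its equality case make the order-reversing state the unique maximum
(`frame_eq_of_sum_le`). -/

namespace LyapunovControl

/-! ### Zeros of the secular function and their half-planes. -/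

section Secular

variable {ι : Type*} [Fintype ι]

/-- The secular function of the rank-one perturbation `i Ω - D`, where the rank-one part has
diagonal `d`. -/
noncomputable def secular (ω d : ι → ℝ) (z : ℂ) : ℂ :=
  1 + ∑ j, (d j : ℂ) / (z - ω j * Complex.I)

lemma re_div_sub_mul_I (c t : ℝ) (z : ℂ) :
    ((c : ℂ) / (z - t * Complex.I)).re = c * z.re / Complex.normSq (z - t * Complex.I) := by
  rw [Complex.div_re]
  simp

/-- All poles lie on the imaginary axis, so each term has a real part with the sign of `d j * z.re`.
No condition on `z` is needed: at a pole both sides use `x / 0 = 0`. -/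
lemma re_secular (ω d : ι → ℝ) (z : ℂ) :
    (secular ω d z).re = 1 + z.re * ∑ j, d j / Complex.normSq (z - ω j * Complex.I) := by
  simp only [secular, Complex.add_re, Complex.one_re, Complex.re_sum, re_div_sub_mul_I,
    Finset.mul_sum]
  congr 1
  exact Finset.sum_congr rfl fun j _ => by ring

lemma re_ne_zero_of_secular_eq_zero {ω d : ι → ℝ} {z : ℂ} (h : secular ω d z = 0) :
    z.re ≠ 0 := by
  intro hz
  have := re_secular ω d z
  simp [h, hz] at this

lemma re_neg_of_secular_eq_zero {ω d : ι → ℝ} {z : ℂ} (hd : ∀ j, 0 ≤ d j)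
    (h : secular ω d z = 0) : z.re < 0 := by
  have := re_secular ω d z
  rw [h, Complex.zero_re] at this
  have h2 : 0 ≤ ∑ j, d j / Complex.normSq (z - ω j * Complex.I) :=
    Finset.sum_nonneg fun j _ => div_nonneg (hd j) (Complex.normSq_nonneg _)
  by_contra! hz
  nlinarith [mul_nonneg hz h2]

lemma secular_neg (ω d : ι → ℝ) (z : ℂ) :
    secular (fun j => -ω j) (fun j => -d j) (-z) = secular ω d z := by
  simp only [secular]
  congr 1
  refine Finset.sum_congr rfl fun j _ => ?_
  rw [← neg_div_neg_eq]
  push_cast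
  congr 1 <;> ring

lemma re_pos_of_secular_eq_zero {ω d : ι → ℝ} {z : ℂ} (hd : ∀ j, d j ≤ 0)
    (h : secular ω d z = 0) : 0 < z.re := by
  have := re_neg_of_secular_eq_zero (z := -z) (d := fun j => -d j) (ω := fun j => -ω j)
    (fun j => neg_nonneg.2 (hd j)) (by rw [secular_neg, h])
  simpa using this

/-- Reflecting a point of the right half-plane in the imaginary axis does not increase its distance
to any point of the closed left half-plane. -/
lemma norm_prod_reflect_le (s : Multiset ℂ) (hs : ∀ a ∈ s, a.re ≤ 0) {z : ℂ} (hz : 0 < z.re) :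
    ‖(s.map fun a => -(starRingEnd ℂ) z - a).prod‖ ≤ ‖(s.map fun a => z - a).prod‖ := by
  induction s using Multiset.induction_on with
  | empty => simp
  | cons a s ih =>
    have ha := hs a (Multiset.mem_cons_self a s)
    simp only [Multiset.map_cons, Multiset.prod_cons, norm_mul]
    refine mul_le_mul ?_ (ih fun b hb => hs b (Multiset.mem_cons_of_mem hb)) (norm_nonneg _)
      (norm_nonneg _)
    rw [← sq_le_sq₀ (norm_nonneg _) (norm_nonneg _), Complex.sq_norm, Complex.sq_norm,
      Complex.normSq_apply, Complex.normSq_apply]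
    simp only [Complex.sub_re, Complex.neg_re, Complex.conj_re, Complex.sub_im, Complex.neg_im,
      Complex.conj_im, neg_neg]
    nlinarith [mul_nonpos_of_nonneg_of_nonpos hz.le ha]

open Polynomial in
/-- The secular function with denominators cleared. -/
noncomputable def secularPoly [DecidableEq ι] (ω d : ι → ℝ) : ℂ[X] :=
  ∏ j, (X - C (ω j * Complex.I)) +
    ∑ j, C (d j : ℂ) * ∏ k ∈ Finset.univ.erase j, (X - C (ω k * Complex.I))

lemma eval_secularPoly [DecidableEq ι] (ω d : ι → ℝ) {z : ℂ} (hz : ∀ j, z ≠ ω j * Complex.I) :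
    (secularPoly ω d).eval z = (∏ j, (z - ω j * Complex.I)) * secular ω d z := by
  simp only [secularPoly, secular, Polynomial.eval_add, Polynomial.eval_prod,
    Polynomial.eval_finsetSum, Polynomial.eval_mul, Polynomial.eval_sub, Polynomial.eval_X,
    Polynomial.eval_C, mul_add, mul_one, Finset.mul_sum]
  congr 1
  refine Finset.sum_congr rfl fun j hj => ?_
  rw [← Finset.mul_prod_erase _ _ hj]
  rw [mul_right_comm, mul_div_assoc', mul_div_cancel_left₀ _ (sub_ne_zero.2 (hz j))]

/-- Clearing denominators creates no spurious roots: at the pole of index `j` only the `j`-th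
summand survives. -/
lemma eval_secularPoly_pole [DecidableEq ι] {ω d : ι → ℝ} (hω : Function.Injective ω)
    (hd : ∀ j, d j ≠ 0) (j : ι) : (secularPoly ω d).eval (ω j * Complex.I) ≠ 0 := by
  simp only [secularPoly, Polynomial.eval_add, Polynomial.eval_prod,
    Polynomial.eval_finsetSum, Polynomial.eval_mul, Polynomial.eval_sub, Polynomial.eval_X,
    Polynomial.eval_C]
  rw [Finset.prod_eq_zero (Finset.mem_univ j) (sub_self _), zero_add,
    Finset.sum_eq_single j, mul_ne_zero_iff, Finset.prod_ne_zero_iff]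
  · refine ⟨by exact_mod_cast hd j, fun k hk => ?_⟩
    rw [← sub_mul, mul_ne_zero_iff, sub_ne_zero]
    refine ⟨?_, Complex.I_ne_zero⟩
    exact_mod_cast fun h => (Finset.ne_of_mem_erase hk) (hω h).symm
  · intro k _ hk
    rw [Finset.prod_eq_zero (Finset.mem_erase.2 ⟨hk.symm, Finset.mem_univ j⟩) (sub_self _),
      mul_zero]
  · simp

/-- If no zero lies in the open right half-plane, the cleared polynomial is no larger at `-conj z`
than at `z`. The factor `∏ (z - i ω_j)` has the same modulus at both points, so the inequality
passes to the secular function. -/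
lemma sum_div_normSq_nonneg {ω d : ι → ℝ} (hω : Function.Injective ω) (hd : ∀ j, d j ≠ 0)
    [Nonempty ι]
    (h : ∀ z, (∀ j, z ≠ ω j * Complex.I) → secular ω d z = 0 → z.re ≤ 0) {z : ℂ}
    (hz : 0 < z.re) : 0 ≤ ∑ j, d j / Complex.normSq (z - ω j * Complex.I) := by
  classical
  have hp := IsAlgClosed.splits (secularPoly ω d)
  have hroots : ∀ a ∈ (secularPoly ω d).roots, a.re ≤ 0 := by
    intro a ha
    have ha0 : (secularPoly ω d).eval a = 0 := (Polynomial.mem_roots'.1 ha).2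
    have hne : ∀ j, a ≠ ω j * Complex.I := by
      rintro j rfl
      exact eval_secularPoly_pole hω hd j ha0
    refine h a hne ?_
    rw [eval_secularPoly ω d hne, mul_eq_zero] at ha0
    refine ha0.resolve_left ?_
    exact Finset.prod_ne_zero_iff.2 fun j _ => sub_ne_zero.2 (hne j)
  have hne : ∀ w : ℂ, w.re ≠ 0 → ∀ j, w ≠ ω j * Complex.I := by
    rintro w hw j rfl
    simp at hw
  have key : ‖(secularPoly ω d).eval (-(starRingEnd ℂ) z)‖ ≤ ‖(secularPoly ω d).eval z‖ := by
    rw [hp.eval_eq_prod_roots, hp.eval_eq_prod_roots, norm_mul, norm_mul]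
    exact mul_le_mul_of_nonneg_left (norm_prod_reflect_le _ hroots hz) (norm_nonneg _)
  have hconj : ∀ j, -(starRingEnd ℂ) z - ω j * Complex.I =
      -(starRingEnd ℂ) (z - ω j * Complex.I) := by
    intro j
    simp
    ring
  rw [eval_secularPoly ω d (hne z hz.ne'), eval_secularPoly ω d (hne _ (by simpa using hz.ne')),
    norm_mul, norm_mul] at key
  have hprod : ‖∏ j, (-(starRingEnd ℂ) z - ω j * Complex.I)‖ =
      ‖∏ j, (z - ω j * Complex.I)‖ := by
    simp only [norm_prod, hconj, norm_neg, RCLike.norm_conj]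
  rw [hprod] at key
  have hpos : 0 < ‖∏ j, (z - ω j * Complex.I)‖ :=
    norm_pos_iff.2 (Finset.prod_ne_zero_iff.2 fun j _ => sub_ne_zero.2 (hne z hz.ne' j))
  have key2 := le_of_mul_le_mul_left key hpos
  have hrefl : secular ω d (-(starRingEnd ℂ) z) = 2 - (starRingEnd ℂ) (secular ω d z) := by
    simp only [secular, hconj, map_add, map_sum, map_div₀, map_one, Complex.conj_ofReal, div_neg,
      Finset.sum_neg_distrib]
    ring
  rw [hrefl, ← sq_le_sq₀ (norm_nonneg _) (norm_nonneg _), Complex.sq_norm, Complex.sq_norm,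
      Complex.normSq_apply, Complex.normSq_apply] at key2
  simp only [Complex.sub_re, Complex.conj_re, Complex.sub_im, Complex.conj_im, Complex.re_ofNat,
    Complex.im_ofNat] at key2
  -- With `s` the secular value at `z`, the inequality reads `|2 - conj s| ≤ |s|`: `s` is at least
  -- as far from `0` as from `2`.
  have hre : 1 ≤ (secular ω d z).re := by nlinarith
  rw [re_secular] at hre
  exact nonneg_of_mul_nonneg_right (by linarith) hz

-- Evaluate the sum of `sum_div_normSq_nonneg` at `z = ε + i ω_j` and multiply by `ε²`. As `ε → 0⁺`
-- only the `j`-th term survives, so absence of such a zero would force `0 ≤ d j`.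
open Filter Topology in
lemma exists_secular_eq_zero_re_pos {ω d : ι → ℝ} (hω : Function.Injective ω)
    (hd : ∀ j, d j ≠ 0) {j : ι} (hj : d j < 0) :
    ∃ z, (∀ j, z ≠ ω j * Complex.I) ∧ secular ω d z = 0 ∧ 0 < z.re := by
  classical
  by_contra! h
  have : Nonempty ι := ⟨j⟩
  have hlim : Tendsto (fun ε : ℝ => ∑ k, d k * (ε ^ 2 / (ε ^ 2 + (ω j - ω k) ^ 2))) (𝓝[>] 0)
      (𝓝 (∑ k, if k = j then d j else 0)) := by
    refine tendsto_finsetSum _ fun k _ => ?_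
    split_ifs with hk
    · subst hk
      refine (tendsto_const_nhds (x := d k)).congr' ?_
      filter_upwards [self_mem_nhdsWithin] with ε hε
      have : ε ≠ 0 := (Set.mem_Ioi.1 hε).ne'
      field_simp
      simp
    · have hne : (ω j - ω k) ^ 2 ≠ 0 := pow_ne_zero _ (sub_ne_zero.2 fun e => hk (hω e).symm)
      have hc : ContinuousAt (fun ε : ℝ => d k * (ε ^ 2 / (ε ^ 2 + (ω j - ω k) ^ 2))) 0 := by
        refine continuousAt_const.mul (ContinuousAt.div (by fun_prop) (by fun_prop) ?_)
        simpa using hne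
      have := hc.tendsto.mono_left (nhdsWithin_le_nhds (s := Set.Ioi (0 : ℝ)))
      simpa using this
  have hge : 0 ≤ ∑ k, if k = j then d j else 0 := by
    refine ge_of_tendsto hlim ?_
    filter_upwards [self_mem_nhdsWithin] with ε hε
    have hε : 0 < ε := hε
    have := sum_div_normSq_nonneg hω hd h (z := ε + ω j * Complex.I) (by simpa using hε)
    have := mul_nonneg (sq_nonneg ε) this
    rw [Finset.mul_sum] at this
    refine this.trans_eq (Finset.sum_congr rfl fun k _ => ?_)
    rw [Complex.normSq_apply]
    simp only [Complex.sub_re, Complex.add_re, Complex.ofReal_re, Complex.mul_re, Complex.I_re,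
      Complex.ofReal_im, Complex.I_im, Complex.sub_im, Complex.add_im, Complex.mul_im]
    ring
  simp at hge
  linarith

lemma exists_secular_eq_zero_re_neg {ω d : ι → ℝ} (hω : Function.Injective ω)
    (hd : ∀ j, d j ≠ 0) {j : ι} (hj : 0 < d j) :
    ∃ z, (∀ j, z ≠ ω j * Complex.I) ∧ secular ω d z = 0 ∧ z.re < 0 := by
  obtain ⟨z, hz, h0, hre⟩ := exists_secular_eq_zero_re_pos (ω := fun j => -ω j)
    (d := fun j => -d j) (j := j) (fun a b h => hω (neg_injective h))
    (fun j => neg_ne_zero.2 (hd j)) (neg_neg_of_pos hj)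
  refine ⟨-z, fun k hk => hz k ?_, ?_, by simpa using hre⟩
  · rw [← neg_neg z, hk]
    push_cast
    ring
  · rw [← h0, ← secular_neg, neg_neg]

/-- Eigenvalues of a diagonal matrix with a rank-one perturbation. -/
lemma exists_eigenvector_iff_secular {ω d : ι → ℝ} (hω : Function.Injective ω)
    (hd : ∀ j, d j ≠ 0) {u c : ι → ℂ} (hu : ∀ j, u j * c j = -d j) (z : ℂ) :
    (∃ x : ι → ℂ, x ≠ 0 ∧ ∀ j, z * x j = ω j * Complex.I * x j + (∑ k, c k * x k) * u j) ↔
      (∀ j, z ≠ ω j * Complex.I) ∧ secular ω d z = 0 := by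
  classical
  have hd' : ∀ j, (d j : ℂ) ≠ 0 := fun j => by exact_mod_cast hd j
  have hu0 : ∀ j, u j ≠ 0 := fun j h => hd' j (by simpa [h] using hu j)
  have hc0 : ∀ j, c j ≠ 0 := fun j h => hd' j (by simpa [h] using hu j)
  constructor
  · rintro ⟨x, hx, h⟩
    -- If the functional killed `x`, then `x` would be an eigenvector of the diagonal part, whose
    -- spectrum is simple. It would be a multiple of a basis vector, on which the functional is
    -- nonzero.
    have hf : ∑ k, c k * x k ≠ 0 := by
      intro hf
      obtain ⟨j, hj⟩ := Function.ne_iff.1 hx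
      have hxj : x j ≠ 0 := hj
      have hz : z = ω j * Complex.I := by
        have := h j
        rw [hf, zero_mul, add_zero] at this
        exact mul_right_cancel₀ hxj this
      have hk : ∀ k, k ≠ j → x k = 0 := by
        intro k hk
        have h1 := h k
        rw [hf, zero_mul, add_zero, hz] at h1
        by_contra hxk
        have h2 := mul_right_cancel₀ Complex.I_ne_zero (mul_right_cancel₀ hxk h1)
        exact hk (hω (by exact_mod_cast h2.symm))
      rw [Finset.sum_eq_single j (fun k _ hkj => by rw [hk k hkj, mul_zero]) (by simp)] at hf
      exact mul_ne_zero (hc0 j) hxj hf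
    have hz : ∀ j, z ≠ ω j * Complex.I := by
      rintro j rfl
      exact mul_ne_zero hf (hu0 j) (by simpa using h j)
    refine ⟨hz, ?_⟩
    have hx' : ∀ j, x j = (∑ k, c k * x k) * u j / (z - ω j * Complex.I) := by
      intro j
      rw [eq_div_iff (sub_ne_zero.2 (hz j))]
      linear_combination h j
    have hsum : ∑ k, c k * x k =
        -(∑ k, c k * x k) * ∑ j, (d j : ℂ) / (z - ω j * Complex.I) := by
      conv_lhs => rw [Finset.sum_congr rfl fun k _ => by rw [hx' k]]
      rw [Finset.mul_sum]
      refine Finset.sum_congr rfl fun j _ => ?_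
      have := hu j
      linear_combination (∑ k, c k * x k) / (z - ω j * Complex.I) * this
    have : (∑ k, c k * x k) * secular ω d z = 0 := by
      rw [secular]
      linear_combination hsum
    exact (mul_eq_zero.1 this).resolve_left hf
  · rintro ⟨hz, h⟩
    have hsum : ∑ k, c k * (u k / (z - ω k * Complex.I)) = 1 := by
      rw [secular] at h
      rw [← sub_eq_zero, ← neg_eq_zero, ← h, neg_sub, sub_eq_add_neg, ← Finset.sum_neg_distrib]
      congr 1
      refine Finset.sum_congr rfl fun j _ => ?_
      have := hu j
      linear_combination -1 / (z - ω j * Complex.I) * this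
    refine ⟨fun j => u j / (z - ω j * Complex.I), ?_, fun j => ?_⟩
    · intro h0
      have h0' : ∀ k, u k / (z - ω k * Complex.I) = 0 := fun k => congrFun h0 k
      simp [h0'] at hsum
    · rw [hsum, one_mul]
      have := sub_ne_zero.2 (hz j)
      field_simp
      ring

end Secular

/-! ### Eigenvalues of a base change to `ℂ`, computed inside an ambient complex space. -/

section BaseChange

open TensorProduct

lemma exists_one_tmul_add_I_tmul {E : Type*} [AddCommGroup E] [Module ℝ E] (t : ℂ ⊗[ℝ] E) :
    ∃ x y : E, t = (1 : ℂ) ⊗ₜ[ℝ] x + Complex.I ⊗ₜ[ℝ] y := by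
  refine ⟨equivFinsuppOfBasisLeft Complex.basisOneI t 0,
    equivFinsuppOfBasisLeft Complex.basisOneI t 1, ?_⟩
  rw [← (equivFinsuppOfBasisLeft Complex.basisOneI).symm_apply_apply t,
    equivFinsuppOfBasisLeft_symm_apply, Finsupp.sum_fintype _ _ (by simp)]
  simp [Fin.sum_univ_two]

lemma one_tmul_add_I_tmul_eq_zero_iff {E : Type*} [AddCommGroup E] [Module ℝ E] {x y : E} :
    (1 : ℂ) ⊗ₜ[ℝ] x + Complex.I ⊗ₜ[ℝ] y = 0 ↔ x = 0 ∧ y = 0 := by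
  refine ⟨fun h => ?_, fun h => by simp [h.1, h.2]⟩
  have h' := congrArg (equivFinsuppOfBasisLeft Complex.basisOneI) h
  have h0 := DFunLike.congr_fun h' 0
  have h1 := DFunLike.congr_fun h' 1
  rw [map_add, Finsupp.add_apply, equivFinsuppOfBasisLeft_apply_tmul_apply,
    equivFinsuppOfBasisLeft_apply_tmul_apply] at h0 h1
  simp at h0 h1
  exact ⟨h0, h1⟩

lemma smul_one_tmul_add_I_tmul {E : Type*} [AddCommGroup E] [Module ℝ E] (z : ℂ) (x y : E) :
    z • ((1 : ℂ) ⊗ₜ[ℝ] x + Complex.I ⊗ₜ[ℝ] y) =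
      (1 : ℂ) ⊗ₜ[ℝ] (z.re • x - z.im • y) + Complex.I ⊗ₜ[ℝ] (z.im • x + z.re • y) := by
  obtain ⟨a, b⟩ := z
  have hz : (⟨a, b⟩ : ℂ) = a • (1 : ℂ) + b • Complex.I := by apply Complex.ext <;> simp
  have hzI : (a • (1 : ℂ) + b • Complex.I) * Complex.I = a • Complex.I - b • (1 : ℂ) := by
    apply Complex.ext <;> simp
  have hre : (a • (1 : ℂ) + b • Complex.I).re = a := by simp
  have him : (a • (1 : ℂ) + b • Complex.I).im = b := by simp
  rw [smul_add, smul_tmul', smul_tmul', smul_eq_mul, smul_eq_mul, mul_one, hz, hzI, hre, him]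
  simp only [add_tmul, sub_tmul, tmul_add, tmul_sub, smul_tmul]
  abel

/-- By `hT'` the subspace `T` is totally real, so its abstract complexification is `T + iT` inside
`W`, and `D` commutes with `i`. Complex eigenvectors can thus be sought among actual matrices. -/
lemma isRestrictedEigenvalue_iff {W : Type*} [AddCommGroup W] [Module ℝ W] [Module ℂ W]
    [IsScalarTower ℝ ℂ W] {D : W →ₗ[ℝ] W} (hD : ∀ x, D (Complex.I • x) = Complex.I • D x)
    {T : Submodule ℝ W} (hT : LeavesInvariant D T)
    (hT' : ∀ x ∈ T, ∀ y ∈ T, x + Complex.I • y = 0 → x = 0 ∧ y = 0) (z : ℂ) :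
    IsRestrictedEigenvalue D T hT z ↔
      ∃ Z : W, Z ≠ 0 ∧ (∃ x ∈ T, ∃ y ∈ T, Z = x + Complex.I • y) ∧ D Z = z • Z := by
  have hsmul : ∀ x y : W, z • (x + Complex.I • y) =
      (z.re • x - z.im • y) + Complex.I • (z.im • x + z.re • y) := by
    intro x y
    have hr : ∀ (r : ℝ) (v : W), r • v = (r : ℂ) • v := fun r v => by
      rw [← Complex.coe_algebraMap, algebraMap_smul]
    obtain ⟨a, b⟩ := z
    simp only [hr]
    rw [Complex.mk_eq_add_mul_I]
    match_scalars
    · ring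
    · linear_combination (b : ℂ) * Complex.I_mul_I
  have key : ∀ x y : T, (D.restrict hT).baseChange ℂ ((1 : ℂ) ⊗ₜ[ℝ] x + Complex.I ⊗ₜ[ℝ] y) =
      z • ((1 : ℂ) ⊗ₜ[ℝ] x + Complex.I ⊗ₜ[ℝ] y) ↔
      D ((x : W) + Complex.I • (y : W)) = z • ((x : W) + Complex.I • (y : W)) := by
    intro x y
    rw [smul_one_tmul_add_I_tmul, hsmul, map_add, map_add, hD, LinearMap.baseChange_tmul,
      LinearMap.baseChange_tmul, ← sub_eq_zero, add_sub_add_comm, ← tmul_sub, ← tmul_sub,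
      one_tmul_add_I_tmul_eq_zero_iff]
    conv_rhs => rw [← sub_eq_zero, add_sub_add_comm, ← smul_sub]
    constructor
    · rintro ⟨h1, h2⟩
      have h1 : D x - (z.re • (x : W) - z.im • (y : W)) = 0 := congrArg Subtype.val h1
      have h2 : D y - (z.im • (x : W) + z.re • (y : W)) = 0 := congrArg Subtype.val h2
      rw [h1, h2, smul_zero, add_zero]
    · intro h
      have := hT' _ (T.sub_mem (hT x x.2) (T.sub_mem (T.smul_mem z.re x.2) (T.smul_mem z.im y.2)))
        _ (T.sub_mem (hT y y.2) (T.add_mem (T.smul_mem z.im x.2) (T.smul_mem z.re y.2))) h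
      exact ⟨Subtype.ext this.1, Subtype.ext this.2⟩
  constructor
  · intro h
    obtain ⟨t, ht⟩ := h.exists_hasEigenvector
    obtain ⟨x, y, rfl⟩ := exists_one_tmul_add_I_tmul t
    refine ⟨(x : W) + Complex.I • (y : W), fun h0 => ht.2 ?_, ⟨x, x.2, y, y.2, rfl⟩,
      (key x y).1 (Module.End.mem_eigenspace_iff.1 ht.1)⟩
    have := hT' x x.2 y y.2 h0
    exact one_tmul_add_I_tmul_eq_zero_iff.2 ⟨Subtype.ext this.1, Subtype.ext this.2⟩
  · rintro ⟨_, h0, ⟨x, hx, y, hy, rfl⟩, h⟩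
    refine Module.End.hasEigenvalue_of_hasEigenvector
      (x := (1 : ℂ) ⊗ₜ[ℝ] (⟨x, hx⟩ : T) + Complex.I ⊗ₜ[ℝ] (⟨y, hy⟩ : T))
      ⟨Module.End.mem_eigenspace_iff.2 ((key ⟨x, hx⟩ ⟨y, hy⟩).2 h), fun h1 => h0 ?_⟩
    obtain ⟨h1, h2⟩ := one_tmul_add_I_tmul_eq_zero_iff.1 h1
    have h1 : x = 0 := congrArg Subtype.val h1
    have h2 : y = 0 := congrArg Subtype.val h2
    simp [h1, h2]

end BaseChange

/-! ### The derivative of the closed-loop field. -/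

section Linearization

variable {n : ℕ}

/-- The complex linear map `X ↦ -i [A, X]`. -/
noncomputable def flowLin (A : CMat n) : CMat n →ₗ[ℂ] CMat n :=
  (-Complex.I) • (LinearMap.mulLeft ℂ A - LinearMap.mulRight ℂ A)

lemma flowLin_apply (A X : CMat n) : flowLin A X = (-Complex.I) • ⁅A, X⁆ := by
  simp [flowLin, Ring.lie_def]

lemma feedback_eq (H₁ ρd ρ : CMat n) : feedback H₁ ρd ρ = (flowLin H₁ ρ * ρd).trace := by
  simp only [feedback, flowLin_apply, Ring.lie_def, smul_mul_assoc, mul_smul_comm, smul_sub]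

/-- The feedback as a complex linear functional of the state. -/
noncomputable def feedbackLin (H₁ ρd : CMat n) : CMat n →ₗ[ℂ] ℂ :=
  Matrix.traceLinearMap (Fin n) ℂ ℂ ∘ₗ LinearMap.mulRight ℂ ρd ∘ₗ flowLin H₁

lemma feedbackLin_apply (H₁ ρd ρ : CMat n) : feedbackLin H₁ ρd ρ = feedback H₁ ρd ρ := by
  simp [feedbackLin, feedback_eq]

lemma vectorField_eq (H₀ H₁ ρd ρ : CMat n) :
    vectorField H₀ H₁ ρd ρ = flowLin H₀ ρ + feedback H₁ ρd ρ • flowLin H₁ ρ := by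
  simp only [vectorField, flowLin_apply, Ring.lie_def, add_mul, mul_add, smul_mul_assoc,
    mul_smul_comm]
  module

/-- The field is a linear map plus a linear functional times a linear map, so this is the product
rule. All three are `ℂ`-linear, hence so is the real derivative. -/
lemma linearization_apply (H₀ H₁ ρd ρ X : CMat n) :
    linearization H₀ H₁ ρd ρ X = flowLin H₀ X +
      (feedback H₁ ρd ρ • flowLin H₁ X + feedback H₁ ρd X • flowLin H₁ ρ) := by
  have hfun : vectorField H₀ H₁ ρd = fun ρ => flowLin H₀ ρ + feedbackLin H₁ ρd ρ • flowLin H₁ ρ := by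
    funext ρ
    rw [vectorField_eq, feedbackLin_apply]
  have hL : ∀ A : CMat n, HasFDerivAt (fun ρ => flowLin A ρ)
      (((flowLin A).restrictScalars ℝ).toContinuousLinearMap) ρ := fun A =>
    (((flowLin A).restrictScalars ℝ).toContinuousLinearMap).hasFDerivAt
  have hf : HasFDerivAt (fun ρ => feedbackLin H₁ ρd ρ)
      (((feedbackLin H₁ ρd).restrictScalars ℝ).toContinuousLinearMap) ρ :=
    (((feedbackLin H₁ ρd).restrictScalars ℝ).toContinuousLinearMap).hasFDerivAt
  have := (hL H₀).add (hf.smul (hL H₁))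
  rw [linearization, hfun]
  erw [this.fderiv]
  rw [← feedbackLin_apply, ← feedbackLin_apply]
  rfl

end Linearization

/-! ### Passage to the eigenbasis and reduction to the secular equation. -/

section Frame

variable {n : ℕ}

/-- Passage from the eigenbasis given by the columns of `U` to the standard basis:
`X ↦ U X Uᴴ`. -/
noncomputable def frame (U : Matrix.unitaryGroup (Fin n) ℂ) : CMat n ≃⋆ₐ[ℂ] CMat n :=
  Unitary.conjStarAlgAut ℂ (CMat n) U

lemma frame_apply (U : Matrix.unitaryGroup (Fin n) ℂ) (X : CMat n) :
    frame U X = U * X * (U : CMat n)ᴴ := rfl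

lemma frame_injective (U : Matrix.unitaryGroup (Fin n) ℂ) : Function.Injective (frame U) :=
  (frame U).injective

lemma frame_surjective (U : Matrix.unitaryGroup (Fin n) ℂ) : Function.Surjective (frame U) :=
  (frame U).surjective

lemma trace_frame (U : Matrix.unitaryGroup (Fin n) ℂ) (X : CMat n) :
    (frame U X).trace = X.trace := by
  rw [frame_apply, Matrix.trace_mul_comm, ← mul_assoc, ← Matrix.star_eq_conjTranspose,
    Unitary.coe_star_mul_self, one_mul]

lemma charpoly_frame (U : Matrix.unitaryGroup (Fin n) ℂ) (X : CMat n) :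
    (frame U X).charpoly = X.charpoly := by
  have h := Matrix.charpoly_units_conj (Unitary.toUnits U) X
  rw [← Matrix.coe_units_inv] at h
  exact h

lemma flowLin_frame (U : Matrix.unitaryGroup (Fin n) ℂ) (A X : CMat n) :
    flowLin (frame U A) (frame U X) = frame U (flowLin A X) := by
  simp only [flowLin_apply, Ring.lie_def, map_smul, map_sub, map_mul]

lemma feedback_frame (U : Matrix.unitaryGroup (Fin n) ℂ) (B w X : CMat n) :
    feedback (frame U B) (frame U w) (frame U X) = feedback B w X := by
  rw [feedback_eq, feedback_eq, flowLin_frame, ← map_mul, trace_frame]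

lemma isHermitian_frame_iff (U : Matrix.unitaryGroup (Fin n) ℂ) {X : CMat n} :
    (frame U X).IsHermitian ↔ X.IsHermitian := by
  rw [Matrix.IsHermitian, Matrix.IsHermitian, ← Matrix.star_eq_conjTranspose,
    ← Matrix.star_eq_conjTranspose, ← map_star, (frame_injective U).eq_iff]

lemma posSemidef_frame (U : Matrix.unitaryGroup (Fin n) ℂ) {X : CMat n} (hX : X.PosSemidef) :
    (frame U X).PosSemidef := by
  rw [frame_apply]
  exact hX.mul_mul_conjTranspose_same _

/-- The complex diagonal matrix with real entries `v`. -/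
abbrev rdiag (v : Fin n → ℝ) : CMat n := Matrix.diagonal fun k => (v k : ℂ)

lemma isHermitian_rdiag (v : Fin n → ℝ) : (rdiag v).IsHermitian := by
  simp [Matrix.IsHermitian, Matrix.diagonal_conjTranspose, Pi.star_def]

lemma flowLin_rdiag_apply (v : Fin n → ℝ) (X : CMat n) (k l : Fin n) :
    flowLin (rdiag v) X k l = (v l - v k) * Complex.I * X k l := by
  rw [flowLin_apply, Ring.lie_def]
  simp only [Matrix.smul_apply, Matrix.sub_apply, Matrix.diagonal_mul, Matrix.mul_diagonal,
    smul_eq_mul]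
  ring

lemma flowLin_apply_rdiag (A : CMat n) (v : Fin n → ℝ) (k l : Fin n) :
    flowLin A (rdiag v) k l = -Complex.I * A k l * (v l - v k) := by
  rw [flowLin_apply, Ring.lie_def]
  simp only [Matrix.smul_apply, Matrix.sub_apply, Matrix.diagonal_mul, Matrix.mul_diagonal,
    smul_eq_mul]
  ring

lemma feedback_rdiag (B : CMat n) (w : Fin n → ℝ) (X : CMat n) :
    feedback B (rdiag w) X =
      ∑ p : Fin n × Fin n, -Complex.I * (w p.2 - w p.1) * B p.2 p.1 * X p.1 p.2 := by
  -- Cyclicity of the trace moves the commutator from `X` onto the diagonal matrix.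
  have h1 : feedback B (rdiag w) X = -(X * flowLin B (rdiag w)).trace := by
    simp only [feedback_eq, flowLin_apply, Ring.lie_def, smul_mul_assoc, mul_smul_comm, sub_mul,
      mul_sub, Matrix.trace_smul, Matrix.trace_sub, smul_eq_mul]
    rw [mul_assoc B X, Matrix.trace_mul_comm B, mul_assoc X, mul_assoc X B]
    ring
  rw [h1, Matrix.trace, Fintype.sum_prod_type, ← Finset.sum_neg_distrib]
  refine Finset.sum_congr rfl fun k _ => ?_
  rw [Matrix.diag_apply, Matrix.mul_apply, ← Finset.sum_neg_distrib]
  refine Finset.sum_congr rfl fun l _ => ?_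
  rw [flowLin_apply_rdiag]
  ring

lemma isHermitian_flowLin {A X : CMat n} (hA : A.IsHermitian) (hX : X.IsHermitian) :
    (flowLin A X).IsHermitian := by
  rw [flowLin_apply, Ring.lie_def, Matrix.IsHermitian, Matrix.conjTranspose_smul,
    Matrix.conjTranspose_sub, Matrix.conjTranspose_mul, Matrix.conjTranspose_mul, hA.eq, hX.eq]
  simp only [RCLike.star_def, map_neg, Complex.conj_I, neg_neg, neg_smul, smul_sub]
  abel

lemma im_feedback {B w X : CMat n} (hB : B.IsHermitian) (hw : w.IsHermitian)
    (hX : X.IsHermitian) : (feedback B w X).im = 0 := by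
  rw [feedback_eq]
  have h := isHermitian_flowLin hB hX
  rw [← Complex.conj_eq_iff_im, starRingEnd_apply, ← Matrix.trace_conjTranspose,
    Matrix.conjTranspose_mul, h.eq, hw.eq, Matrix.trace_mul_comm]

/-- In an eigenbasis of a generic `ρ` the tangent space at `ρ` consists of the Hermitian matrices
with zero diagonal. -/
lemma frame_mem_tangentSpace_iff (U : Matrix.unitaryGroup (Fin n) ℂ) {v : Fin n → ℝ}
    (hv : Function.Injective v) (X : CMat n) :
    frame U X ∈ tangentSpace (frame U (rdiag v)) ↔ X.IsHermitian ∧ ∀ k, X k k = 0 := by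
  constructor
  · rintro ⟨K, hK, h⟩
    obtain ⟨K, rfl⟩ := frame_surjective U K
    rw [← flowLin_apply, flowLin_frame, (frame_injective U).eq_iff] at h
    rw [isHermitian_frame_iff] at hK
    rw [h]
    refine ⟨isHermitian_flowLin hK (isHermitian_rdiag v), fun k => ?_⟩
    rw [flowLin_apply_rdiag, sub_self, mul_zero]
  · rintro ⟨hX, h0⟩
    -- Entrywise solution of `-i [K, diag v] = X`; on the diagonal `x / 0 = 0` gives `K k k = 0`.
    let K : CMat n := Matrix.of fun k l => Complex.I * X k l / (v l - v k)
    have hK : K.IsHermitian := by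
      ext k l
      have := hX.apply k l
      simp only [K, Matrix.conjTranspose_apply, Matrix.of_apply, RCLike.star_def, map_div₀,
        map_mul, Complex.conj_I, map_sub, Complex.conj_ofReal] at this ⊢
      rw [this, ← neg_div_neg_eq]
      congr 1 <;> ring
    refine ⟨frame U K, (isHermitian_frame_iff U).2 hK, ?_⟩
    rw [← flowLin_apply, flowLin_frame]
    congr 1
    ext k l
    rw [flowLin_apply_rdiag]
    by_cases hkl : k = l
    · subst hkl
      simp [h0]
    · have : (v l - v k : ℂ) ≠ 0 := by
        rw [sub_ne_zero]
        exact_mod_cast fun e => hkl (hv e).symm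
      simp only [K, Matrix.of_apply]
      field_simp
      linear_combination X k l * Complex.I_sq

/-- A zero-diagonal `Z` splits as `x + i y` with `x`, `y` Hermitian, and both parts again have zero
diagonal. -/
lemma frame_mem_complexified_tangentSpace_iff (U : Matrix.unitaryGroup (Fin n) ℂ) {v : Fin n → ℝ}
    (hv : Function.Injective v) (Z : CMat n) :
    (∃ x ∈ tangentSpace (frame U (rdiag v)), ∃ y ∈ tangentSpace (frame U (rdiag v)),
      frame U Z = x + Complex.I • y) ↔ ∀ k, Z k k = 0 := by
  constructor
  · rintro ⟨x, hx, y, hy, h⟩ k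
    obtain ⟨x, rfl⟩ := frame_surjective U x
    obtain ⟨y, rfl⟩ := frame_surjective U y
    rw [frame_mem_tangentSpace_iff U hv] at hx hy
    rw [← map_smul, ← map_add, (frame_injective U).eq_iff] at h
    rw [h]
    simp [hx.2 k, hy.2 k]
  · intro h
    refine ⟨frame U ((1 / 2 : ℂ) • (Z + Zᴴ)), (frame_mem_tangentSpace_iff U hv _).2 ⟨?_, ?_⟩,
      frame U ((-Complex.I / 2) • (Z - Zᴴ)), (frame_mem_tangentSpace_iff U hv _).2 ⟨?_, ?_⟩, ?_⟩
    · rw [Matrix.IsHermitian, Matrix.conjTranspose_smul, Matrix.conjTranspose_add,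
        Matrix.conjTranspose_conjTranspose, add_comm]
      simp
    · intro k
      simp [h k]
    · rw [Matrix.IsHermitian, Matrix.conjTranspose_smul, Matrix.conjTranspose_sub,
        Matrix.conjTranspose_conjTranspose, ← neg_sub Z, smul_neg, ← neg_smul]
      simp [neg_div]
    · intro k
      simp [h k]
    · rw [← map_smul, ← map_add]
      congr 1
      rw [smul_smul, show Complex.I * (-Complex.I / 2) = 1 / 2 by
        linear_combination (-1 / 2 : ℂ) * Complex.I_mul_I]
      module

lemma eq_zero_of_mem_tangentSpace (U : Matrix.unitaryGroup (Fin n) ℂ) {v : Fin n → ℝ}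
    (hv : Function.Injective v) {x y : CMat n} (hx : x ∈ tangentSpace (frame U (rdiag v)))
    (hy : y ∈ tangentSpace (frame U (rdiag v))) (h : x + Complex.I • y = 0) : x = 0 ∧ y = 0 := by
  obtain ⟨x, rfl⟩ := frame_surjective U x
  obtain ⟨y, rfl⟩ := frame_surjective U y
  replace hx := ((frame_mem_tangentSpace_iff U hv _).1 hx).1
  replace hy := ((frame_mem_tangentSpace_iff U hv _).1 hy).1
  rw [← map_smul, ← map_add, map_eq_zero_iff _ (frame_injective U)] at h
  rw [map_eq_zero_iff _ (frame_injective U), map_eq_zero_iff _ (frame_injective U)]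
  have h' := congrArg Matrix.conjTranspose h
  rw [Matrix.conjTranspose_add, Matrix.conjTranspose_smul, hx.eq, hy.eq] at h'
  simp only [RCLike.star_def, Complex.conj_I, Matrix.conjTranspose_zero, neg_smul] at h'
  have hx0 : (2 : ℂ) • x = 0 := by
    rw [← add_zero (0 : CMat n)]
    nth_rw 1 [← h]
    rw [← h']
    module
  have hx0 := (smul_eq_zero.1 hx0).resolve_left two_ne_zero
  refine ⟨hx0, ?_⟩
  rw [hx0, zero_add] at h
  exact (smul_eq_zero.1 h).resolve_left Complex.I_ne_zero

lemma feedback_rdiag_rdiag (B : CMat n) (v w : Fin n → ℝ) :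
    feedback B (rdiag w) (rdiag v) = 0 := by
  rw [feedback_rdiag]
  refine Finset.sum_eq_zero fun p _ => ?_
  by_cases h : p.1 = p.2
  · simp [h]
  · simp [Matrix.diagonal_apply_ne _ h]

/-- The feedback vanishes at diagonal states, so only its derivative survives and contributes a term
of rank at most one. -/
lemma linearization_frame (U : Matrix.unitaryGroup (Fin n) ℂ) (B X : CMat n) (a v w : Fin n → ℝ) :
    linearization (frame U (rdiag a)) (frame U B) (frame U (rdiag w)) (frame U (rdiag v))
      (frame U X) = frame U (flowLin (rdiag a) X +
        feedback B (rdiag w) X • flowLin B (rdiag v)) := by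
  rw [linearization_apply, feedback_frame, feedback_frame, feedback_rdiag_rdiag, zero_smul,
    zero_add, flowLin_frame, flowLin_frame, ← map_smul, ← map_add]

lemma leavesInvariant_linearization (U : Matrix.unitaryGroup (Fin n) ℂ) {B : CMat n}
    (hB : B.IsHermitian) (a w : Fin n → ℝ) {v : Fin n → ℝ} (hv : Function.Injective v) :
    LeavesInvariant
      (linearization (frame U (rdiag a)) (frame U B) (frame U (rdiag w)) (frame U (rdiag v)))
      (tangentSpace (frame U (rdiag v))) := by
  intro X hX
  obtain ⟨X, rfl⟩ := frame_surjective U X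
  rw [frame_mem_tangentSpace_iff U hv] at hX
  rw [linearization_frame, frame_mem_tangentSpace_iff U hv]
  constructor
  · refine (isHermitian_flowLin (isHermitian_rdiag a) hX.1).add ?_
    have h := isHermitian_flowLin hB (isHermitian_rdiag v)
    have h2 := im_feedback hB (isHermitian_rdiag w) hX.1
    rw [Matrix.IsHermitian, Matrix.conjTranspose_smul, h.eq, RCLike.star_def,
      Complex.conj_eq_iff_im.2 h2]
  · intro k
    simp [flowLin_rdiag_apply, flowLin_apply_rdiag]

/-- Off-diagonal positions of an `n × n` matrix. -/
abbrev OffDiag (n : ℕ) : Type := {p : Fin n × Fin n // p.1 ≠ p.2}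

/-- The transition frequencies. -/
def freq (a : Fin n → ℝ) (p : OffDiag n) : ℝ := a p.1.2 - a p.1.1

/-- The diagonal weights of the rank-one part of the linearization. -/
noncomputable def weight (B : CMat n) (v w : Fin n → ℝ) (p : OffDiag n) : ℝ :=
  Complex.normSq (B p.1.1 p.1.2) * ((v p.1.2 - v p.1.1) * (w p.1.2 - w p.1.1))

lemma freq_injective {a : Fin n → ℝ} (ha : StronglyRegular a) : Function.Injective (freq a) := by
  intro p q h
  obtain ⟨h1, h2⟩ := ha _ _ _ _ p.2 q.2 h
  exact Subtype.ext (Prod.ext h1 h2)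

lemma weight_ne_zero {B : CMat n} (hB : FullyConnected B) {v w : Fin n → ℝ}
    (hv : Function.Injective v) (hw : Function.Injective w) (p : OffDiag n) :
    weight B v w p ≠ 0 := by
  have h : ∀ u : Fin n → ℝ, Function.Injective u → u p.1.2 - u p.1.1 ≠ 0 := fun u hu =>
    sub_ne_zero.2 fun e => p.2 (hu e).symm
  exact mul_ne_zero (by simpa using hB _ _ p.2) (mul_ne_zero (h v hv) (h w hw))

/-- The eigenvalues of the linearization on the tangent space are the zeros of the secular
function. -/
lemma isRestrictedEigenvalue_linearization_iff (U : Matrix.unitaryGroup (Fin n) ℂ) {B : CMat n}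
    (hB : B.IsHermitian) (hB' : FullyConnected B) {a v w : Fin n → ℝ} (ha : StronglyRegular a)
    (hv : Function.Injective v) (hw : Function.Injective w)
    (hT : LeavesInvariant
      (linearization (frame U (rdiag a)) (frame U B) (frame U (rdiag w)) (frame U (rdiag v)))
      (tangentSpace (frame U (rdiag v)))) (z : ℂ) :
    IsRestrictedEigenvalue _ _ hT z ↔
      (∀ j, z ≠ freq a j * Complex.I) ∧ secular (freq a) (weight B v w) z = 0 := by
  -- Here `u` is the control direction `-i [B, diag v]` and `c` holds the coefficients of the
  -- feedback functional; `u * c = -weight` because `B` is Hermitian.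
  rw [isRestrictedEigenvalue_iff (fun X => ?_) hT
    (fun x hx y hy h => eq_zero_of_mem_tangentSpace U hv hx hy h),
    ← exists_eigenvector_iff_secular (freq_injective ha) (weight_ne_zero hB' hv hw)
      (u := fun p => flowLin B (rdiag v) p.1.1 p.1.2)
      (c := fun p => -Complex.I * (w p.1.2 - w p.1.1) * B p.1.2 p.1.1) (fun p => ?_)]
  · have hsum : ∀ Z : CMat n, (∀ k, Z k k = 0) → feedback B (rdiag w) Z = ∑ p : OffDiag n,
        -Complex.I * (w p.1.2 - w p.1.1) * B p.1.2 p.1.1 * Z p.1.1 p.1.2 := by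
      intro Z hZ
      rw [feedback_rdiag]
      rw [← Fintype.sum_subtype_add_sum_subtype (fun p : Fin n × Fin n => p.1 ≠ p.2)]
      refine add_eq_left.2 (Finset.sum_eq_zero fun p _ => ?_)
      rw [not_ne_iff.1 p.2, sub_self, mul_zero, zero_mul, zero_mul]
    constructor
    · rintro ⟨Z, hZ0, hZ, h⟩
      obtain ⟨Z, rfl⟩ := frame_surjective U Z
      rw [frame_mem_complexified_tangentSpace_iff U hv] at hZ
      rw [linearization_frame, ← map_smul (frame U), (frame_injective U).eq_iff, hsum Z hZ] at h
      refine ⟨fun p => Z p.1.1 p.1.2, fun h0 => hZ0 ?_, fun p => ?_⟩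
      · rw [map_eq_zero_iff _ (frame_injective U)]
        ext k l
        by_cases hkl : k = l
        · rw [hkl, hZ, Matrix.zero_apply]
        · exact congrFun h0 ⟨(k, l), hkl⟩
      · have := congrFun (congrFun h p.1.1) p.1.2
        rw [Matrix.smul_apply, Matrix.add_apply, Matrix.smul_apply, flowLin_rdiag_apply] at this
        rw [freq, Complex.ofReal_sub]
        exact this.symm
    · rintro ⟨x, hx, h⟩
      let Z : CMat n := Matrix.of fun k l => if hkl : k ≠ l then x ⟨(k, l), hkl⟩ else 0
      have hZ : ∀ k, Z k k = 0 := fun k => by simp [Z]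
      have hZx : ∀ p : OffDiag n, Z p.1.1 p.1.2 = x p := fun p => by simp [Z, p.2]
      refine ⟨frame U Z, ?_, (frame_mem_complexified_tangentSpace_iff U hv Z).2 hZ, ?_⟩
      · rw [Ne, map_eq_zero_iff _ (frame_injective U)]
        intro h0
        refine hx (funext fun p => ?_)
        rw [← hZx, h0]
        rfl
      · rw [linearization_frame, ← map_smul (frame U), (frame_injective U).eq_iff, hsum Z hZ]
        ext k l
        rw [Matrix.smul_apply, Matrix.add_apply, Matrix.smul_apply, flowLin_rdiag_apply]
        by_cases hkl : k = l
        · subst hkl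
          simp [hZ, flowLin_apply_rdiag]
        · have := h ⟨(k, l), hkl⟩
          simp only [hZx]
          rw [hZx ⟨(k, l), hkl⟩, smul_eq_mul, smul_eq_mul, this, freq, Complex.ofReal_sub]
  · rw [flowLin_apply_rdiag, weight]
    have h1 := hB.apply p.1.1 p.1.2
    push_cast
    rw [← h1, RCLike.star_def, Complex.normSq_conj, Complex.normSq_eq_conj_mul_self]
    linear_combination ((starRingEnd ℂ) (B p.1.2 p.1.1) * B p.1.2 p.1.1 *
      (v p.1.2 - v p.1.1) * (w p.1.2 - w p.1.1)) * Complex.I_mul_I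
  · obtain ⟨X, rfl⟩ := frame_surjective U X
    rw [← map_smul (frame U), linearization_frame, linearization_frame, ← map_smul (frame U), smul_add,
      map_smul (flowLin _), ← feedbackLin_apply, ← feedbackLin_apply, map_smul (feedbackLin _ _),
      smul_smul, smul_eq_mul]

end Frame

/-! ### Order-reversing permutations and rearrangement. -/

section Permutations

variable {n : ℕ}

lemma perm_eq_one_of_strictMono {g : Equiv.Perm (Fin n)} (hg : StrictMono g) : g = 1 := by
  have hg' : StrictMono g.symm := fun i j hij => by
    rw [← hg.lt_iff_lt, g.apply_symm_apply, g.apply_symm_apply]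
    exact hij
  ext i
  congr 1
  refine le_antisymm ?_ (hg.le_apply)
  have := hg'.le_apply (x := g i)
  rwa [g.symm_apply_apply] at this

lemma strictMono_comp_sort {w : Fin n → ℝ} (hw : Function.Injective w) :
    StrictMono (w ∘ Tuple.sort w) :=
  (Tuple.monotone_sort w).strictMono_of_injective (hw.comp (Tuple.sort w).injective)

/-- Conjugation by the sorting permutation of `w` transports the claim to the usual order of `Fin
n`. -/
lemma perm_eq_one_of_lt_imp_lt {w : Fin n → ℝ} (hw : Function.Injective w)
    {σ : Equiv.Perm (Fin n)} (hσ : ∀ i j, w i < w j → w (σ i) < w (σ j)) : σ = 1 := by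
  set s := Tuple.sort w
  have hs : StrictMono (w ∘ s) := strictMono_comp_sort hw
  have h : s⁻¹ * σ * s = 1 := by
    refine perm_eq_one_of_strictMono fun i j hij => ?_
    rw [← hs.lt_iff_lt]
    simpa using hσ _ _ (hs hij)
  rw [mul_assoc, inv_mul_eq_one] at h
  exact mul_eq_right.1 h.symm

/-- `σ` reverses the order of the values of `w`. -/
def Reverses (w : Fin n → ℝ) (σ : Equiv.Perm (Fin n)) : Prop :=
  ∀ i j, w i < w j → w (σ j) < w (σ i)

lemma exists_reverses {w : Fin n → ℝ} (hw : Function.Injective w) : ∃ σ, Reverses w σ := by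
  set s := Tuple.sort w
  have hs : StrictMono (w ∘ s) := strictMono_comp_sort hw
  refine ⟨s * Fin.revPerm * s⁻¹, fun i j hij => ?_⟩
  have h : s⁻¹ i < s⁻¹ j := by
    rw [← hs.lt_iff_lt]
    simpa using hij
  simpa using hs (Fin.rev_lt_rev.2 h)

/-- The quotient `σ * τ⁻¹` of two order-reversing permutations preserves the order. -/
lemma Reverses.eq {w : Fin n → ℝ} (hw : Function.Injective w) {σ τ : Equiv.Perm (Fin n)}
    (hσ : Reverses w σ) (hτ : Reverses w τ) : σ = τ := by
  rw [← mul_inv_eq_one]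
  refine perm_eq_one_of_lt_imp_lt hw fun i j hij => ?_
  obtain ⟨i, rfl⟩ := τ.surjective i
  obtain ⟨j, rfl⟩ := τ.surjective j
  simp only [Equiv.Perm.mul_apply, Equiv.Perm.inv_def, Equiv.symm_apply_apply]
  refine hσ _ _ (lt_of_le_of_ne (not_lt.1 fun h => (hτ _ _ h).not_gt hij) fun h => ?_)
  rw [hw h] at hij
  exact lt_irrefl _ hij

/-- This gives access to the rearrangement inequality and its equality case; injectivity of `w`
upgrades the weak inequality to a strict one. -/
lemma reverses_iff_antivary {w : Fin n → ℝ} (hw : Function.Injective w)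
    {σ : Equiv.Perm (Fin n)} : Reverses w σ ↔ Antivary w (w ∘ σ) := by
  constructor
  · intro h i j hij
    by_contra! hlt
    exact (h i j hlt).not_gt hij
  · intro h i j hij
    refine lt_of_le_of_ne (not_lt.1 fun hlt => (h hlt).not_gt hij) fun he => ?_
    rw [σ.injective (hw he)] at hij
    exact lt_irrefl _ hij

lemma sum_mul_le_of_reverses {w : Fin n → ℝ} (hw : Function.Injective w)
    {τ : Equiv.Perm (Fin n)} (hτ : Reverses w τ) (σ : Equiv.Perm (Fin n)) :
    ∑ i, w i * w (τ i) ≤ ∑ i, w i * w (σ i) := by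
  simpa using ((reverses_iff_antivary hw).1 hτ).sum_mul_le_sum_mul_comp_perm (σ := τ⁻¹ * σ)

lemma eq_of_sum_mul_eq {w : Fin n → ℝ} (hw : Function.Injective w)
    {τ σ : Equiv.Perm (Fin n)} (hτ : Reverses w τ)
    (h : ∑ i, w i * w (σ i) = ∑ i, w i * w (τ i)) : σ = τ := by
  refine Reverses.eq hw ((reverses_iff_antivary hw).2 ?_) hτ
  have := ((reverses_iff_antivary hw).1 hτ).sum_mul_eq_sum_mul_comp_perm_iff (σ := τ⁻¹ * σ)
  have h2 := this.1 (by simpa using h)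
  have h3 : (w ∘ τ) ∘ (τ⁻¹ * σ : Equiv.Perm (Fin n)) = w ∘ σ := by
    ext i
    simp
  rwa [h3] at h2

lemma exists_perm_of_prod_X_sub_C_eq {v w : Fin n → ℝ} (hw : Function.Injective w)
    (h : (rdiag v).charpoly = (rdiag w).charpoly) : ∃ σ : Equiv.Perm (Fin n), v = w ∘ σ := by
  have hroots : ∀ u : Fin n → ℝ, (rdiag u).charpoly.roots =
      Finset.univ.val.map fun i => (u i : ℂ) := by
    intro u
    rw [Matrix.charpoly_diagonal, ← Polynomial.roots_multiset_prod_X_sub_C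
      (Finset.univ.val.map fun i => (u i : ℂ)), Multiset.map_map]
    rfl
  have hms := congrArg Polynomial.roots h
  rw [hroots, hroots] at hms
  have hwC : Function.Injective fun i => (w i : ℂ) := Complex.ofReal_injective.comp hw
  have hv : Function.Injective v := by
    have hnd : (Finset.univ.val.map fun i => (v i : ℂ)).Nodup := by
      rw [hms]
      exact (Multiset.nodup_map_iff_of_injective hwC).2 Finset.univ.nodup
    intro i j hij
    exact Multiset.inj_on_of_nodup_map hnd i (Finset.mem_univ i) j (Finset.mem_univ j)
      (by simp [hij])
  have hmem : ∀ i, ∃ j, w j = v i := by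
    intro i
    have : (v i : ℂ) ∈ Finset.univ.val.map fun i => (w i : ℂ) := by
      rw [← hms]
      exact Multiset.mem_map_of_mem _ (Finset.mem_univ i)
    obtain ⟨j, _, hj⟩ := Multiset.mem_map.1 this
    exact ⟨j, by exact_mod_cast hj⟩
  choose f hf using hmem
  have hfi : Function.Injective f := fun i j hij => hv (by rw [← hf, ← hf, hij])
  exact ⟨Equiv.ofBijective f (Finite.injective_iff_bijective.1 hfi), funext fun i => (hf i).symm⟩

lemma charpoly_rdiag_comp (w : Fin n → ℝ) (σ : Equiv.Perm (Fin n)) :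
    (rdiag (w ∘ σ)).charpoly = (rdiag w).charpoly := by
  rw [Matrix.charpoly_diagonal, Matrix.charpoly_diagonal]
  exact Equiv.prod_comp σ fun i => Polynomial.X - Polynomial.C (w i : ℂ)

end Permutations

/-! ### Stationary states as permutations of the spectrum. -/

section Stationary

variable {n : ℕ}

/-- Multiply the field by `ρd` and take the trace: the drift drops out because `ρd` commutes with
`H₀`, and the control term contributes `f(ρ)²`. -/
lemma feedback_eq_zero_of_vectorField_eq_zero {H₀ H₁ ρd ρ : CMat n} (hstat : ⁅H₀, ρd⁆ = 0)
    (h : vectorField H₀ H₁ ρd ρ = 0) : feedback H₁ ρd ρ = 0 := by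
  have h0 : (flowLin H₀ ρ * ρd).trace = 0 := by
    rw [Ring.lie_def, sub_eq_zero] at hstat
    rw [flowLin_apply, smul_mul_assoc, Matrix.trace_smul, Ring.lie_def, sub_mul, mul_assoc ρ,
      hstat, Matrix.trace_sub, mul_assoc, Matrix.trace_mul_comm, mul_assoc, sub_self, smul_zero]
  rw [vectorField_eq] at h
  have h1 := congrArg (fun X => (X * ρd).trace) h
  simp only [add_mul, smul_mul_assoc, Matrix.trace_add, Matrix.trace_smul, h0, zero_mul,
    Matrix.trace_zero, ← feedback_eq, zero_add, smul_eq_mul, mul_self_eq_zero] at h1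
  exact h1

lemma rdiag_apply (v : Fin n → ℝ) (k l : Fin n) :
    rdiag v k l = if k = l then (v k : ℂ) else 0 :=
  Matrix.diagonal_apply _ k l

lemma eq_rdiag_of_flowLin_eq_zero {a : Fin n → ℝ} (ha : Function.Injective a) {X : CMat n}
    (hX : X.IsHermitian) (h : flowLin (rdiag a) X = 0) : ∃ v : Fin n → ℝ, X = rdiag v := by
  refine ⟨fun k => (X k k).re, Matrix.ext fun k l => ?_⟩
  rw [rdiag_apply]
  by_cases hkl : k = l
  · subst hkl
    rw [if_pos rfl]
    have := hX.apply k k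
    rw [RCLike.star_def, Complex.conj_eq_iff_re] at this
    exact this.symm
  · rw [if_neg hkl]
    have h1 := congrFun (congrFun h k) l
    rw [flowLin_rdiag_apply, Matrix.zero_apply] at h1
    refine (mul_eq_zero.1 h1).resolve_left (mul_ne_zero (sub_ne_zero.2 ?_) Complex.I_ne_zero)
    exact_mod_cast fun e => hkl (ha e).symm

/-- Equal levels would make the transitions `(k, l)` and `(l, k)` share the frequency `0`. -/
lemma StronglyRegular.injective {a : Fin n → ℝ} (ha : StronglyRegular a) :
    Function.Injective a := by
  intro k l h
  by_contra hkl
  exact hkl (ha k l l k hkl (Ne.symm hkl) (by rw [h])).1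

lemma flowLin_rdiag_rdiag (a v : Fin n → ℝ) : flowLin (rdiag a) (rdiag v) = 0 := by
  ext k l
  rw [flowLin_rdiag_apply, Matrix.zero_apply]
  by_cases h : k = l
  · simp [h]
  · simp [Matrix.diagonal_apply_ne _ h]

lemma frame_rdiag_mem_stateManifold (U : Matrix.unitaryGroup (Fin n) ℂ) {w : Fin n → ℝ}
    (hw : IsDensity (frame U (rdiag w))) (σ : Equiv.Perm (Fin n)) :
    frame U (rdiag (w ∘ σ)) ∈ stateManifold (frame U (rdiag w)) := by
  obtain ⟨hpsd, htr⟩ := hw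
  have hpsd' : (rdiag w).PosSemidef := by
    have h := hpsd.conjTranspose_mul_mul_same (U : CMat n)
    have h2 : (U : CMat n)ᴴ * frame U (rdiag w) * (U : CMat n) = rdiag w :=
      (frame U).symm_apply_apply (rdiag w)
    rwa [h2] at h
  rw [Matrix.posSemidef_diagonal_iff] at hpsd'
  refine ⟨⟨posSemidef_frame U (Matrix.posSemidef_diagonal_iff.2 fun i => hpsd' (σ i)), ?_⟩, ?_⟩
  · rw [trace_frame, Matrix.trace_diagonal] at htr ⊢
    rw [← htr]
    exact Equiv.sum_comp σ fun i => (w i : ℂ)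
  · rw [charpoly_frame, charpoly_frame, charpoly_rdiag_comp]

lemma mem_stationaryStates_iff (U : Matrix.unitaryGroup (Fin n) ℂ) {B : CMat n}
    {a w : Fin n → ℝ} (ha : Function.Injective a) (hw : Function.Injective w)
    (hdens : IsDensity (frame U (rdiag w))) {ρ : CMat n} :
    ρ ∈ stationaryStates (frame U (rdiag a)) (frame U B) (frame U (rdiag w)) ↔
      ∃ σ : Equiv.Perm (Fin n), ρ = frame U (rdiag (w ∘ σ)) := by
  constructor
  · rintro ⟨⟨hρ, hχ⟩, h⟩
    have hstat : ⁅frame U (rdiag a), frame U (rdiag w)⁆ = 0 := by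
      have h1 := flowLin_frame U (rdiag a) (rdiag w)
      rw [flowLin_rdiag_rdiag, map_zero, flowLin_apply] at h1
      exact (smul_eq_zero.1 h1).resolve_left (neg_ne_zero.2 Complex.I_ne_zero)
    have hf := feedback_eq_zero_of_vectorField_eq_zero hstat h
    rw [vectorField_eq, hf, zero_smul, add_zero] at h
    obtain ⟨X, rfl⟩ := frame_surjective U ρ
    rw [flowLin_frame, map_eq_zero_iff _ (frame_injective U)] at h
    obtain ⟨v, rfl⟩ := eq_rdiag_of_flowLin_eq_zero ha
      ((isHermitian_frame_iff U).1 hρ.1.isHermitian) h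
    rw [charpoly_frame, charpoly_frame] at hχ
    obtain ⟨σ, rfl⟩ := exists_perm_of_prod_X_sub_C_eq hw hχ
    exact ⟨σ, rfl⟩
  · rintro ⟨σ, rfl⟩
    refine ⟨frame_rdiag_mem_stateManifold U hdens σ, ?_⟩
    rw [vectorField_eq, feedback_frame, feedback_rdiag_rdiag, zero_smul, add_zero, flowLin_frame,
      flowLin_rdiag_rdiag, map_zero]

lemma frame_rdiag_comp_injective (U : Matrix.unitaryGroup (Fin n) ℂ) {w : Fin n → ℝ}
    (hw : Function.Injective w) :
    Function.Injective fun σ : Equiv.Perm (Fin n) => frame U (rdiag (w ∘ σ)) := by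
  intro σ τ h
  have h1 := Matrix.diagonal_injective (frame_injective U h)
  ext i
  have h2 := congrFun h1 i
  simp only [Function.comp_apply] at h2
  exact congrArg Fin.val (hw (by exact_mod_cast h2))

lemma stationaryStates_eq_range (U : Matrix.unitaryGroup (Fin n) ℂ) {B : CMat n}
    {a w : Fin n → ℝ} (ha : Function.Injective a) (hw : Function.Injective w)
    (hdens : IsDensity (frame U (rdiag w))) :
    stationaryStates (frame U (rdiag a)) (frame U B) (frame U (rdiag w)) =
      Set.range fun σ : Equiv.Perm (Fin n) => frame U (rdiag (w ∘ σ)) := by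
  ext ρ
  rw [mem_stationaryStates_iff U ha hw hdens, Set.mem_range]
  exact exists_congr fun σ => eq_comm

lemma encard_stationaryStates (U : Matrix.unitaryGroup (Fin n) ℂ) {B : CMat n}
    {a w : Fin n → ℝ} (ha : Function.Injective a) (hw : Function.Injective w)
    (hdens : IsDensity (frame U (rdiag w))) :
    (stationaryStates (frame U (rdiag a)) (frame U B) (frame U (rdiag w))).encard =
      ((n !) : ℕ∞) := by
  rw [stationaryStates_eq_range U ha hw hdens, ← Set.image_univ,
    (frame_rdiag_comp_injective U hw).encard_image, Set.encard_univ, ENat.card_eq_coe_natCard,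
    Nat.card_eq_fintype_card, Fintype.card_perm, Fintype.card_fin]

lemma injective_of_isGeneric (U : Matrix.unitaryGroup (Fin n) ℂ) {w : Fin n → ℝ}
    (h : IsGeneric (frame U (rdiag w))) : Function.Injective w := by
  have h1 : spectrum ℂ (frame U (rdiag w)) = Set.range fun k => (w k : ℂ) :=
    (AlgEquiv.spectrum_eq (frame U) (rdiag w)).trans (spectrum_diagonal _)
  rw [IsGeneric, h1, ← Set.image_univ] at h
  have h2 : Set.InjOn (fun k => (w k : ℂ)) Set.univ := by
    refine Set.injOn_of_ncard_image_eq ?_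
    rw [h, Set.ncard_univ, Nat.card_eq_fintype_card, Fintype.card_fin]
  exact fun i j hij => h2 (Set.mem_univ i) (Set.mem_univ j) (by simp [hij])

end Stationary

/-! ### The unique maximum of `V` on the manifold. -/

section Maximum

variable {n : ℕ}

lemma frame_mul (U V : Matrix.unitaryGroup (Fin n) ℂ) (X : CMat n) :
    frame (U * V) X = frame U (frame V X) :=
  Unitary.conjStarAlgAut_mul_apply U V X

lemma exists_frame_rdiag_of_mem_stateManifold (U : Matrix.unitaryGroup (Fin n) ℂ)
    {w : Fin n → ℝ} (hw : Function.Injective w) {ρ : CMat n}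
    (hρ : ρ ∈ stateManifold (frame U (rdiag w))) :
    ∃ (W : Matrix.unitaryGroup (Fin n) ℂ) (π : Equiv.Perm (Fin n)),
      ρ = frame U (frame W (rdiag (w ∘ π))) := by
  have hH := hρ.1.1.isHermitian
  have hspec : ρ = frame hH.eigenvectorUnitary (rdiag hH.eigenvalues) := hH.spectral_theorem
  have hχ := hρ.2
  rw [hspec, charpoly_frame, charpoly_frame] at hχ
  obtain ⟨π, hπ⟩ := exists_perm_of_prod_X_sub_C_eq hw hχ
  refine ⟨U⁻¹ * hH.eigenvectorUnitary, π, ?_⟩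
  rw [← frame_mul, mul_inv_cancel_left, ← hπ]
  exact hspec

lemma frame_rdiag_apply (W : Matrix.unitaryGroup (Fin n) ℂ) (v : Fin n → ℝ) (k l : Fin n) :
    frame W (rdiag v) k l = ∑ i, W.1 k i * v i * star (W.1 l i) := by
  rw [frame_apply, Matrix.mul_apply]
  refine Finset.sum_congr rfl fun i _ => ?_
  rw [Matrix.mul_diagonal, Matrix.conjTranspose_apply]

lemma lyapunov_frame (U : Matrix.unitaryGroup (Fin n) ℂ) (w X : CMat n) :
    lyapunov (frame U w) (frame U X) = lyapunov w X := by
  rw [lyapunov, lyapunov, ← map_sub, ← Matrix.star_eq_conjTranspose, ← map_star, ← map_mul,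
    trace_frame, Matrix.star_eq_conjTranspose]

/-- The doubly stochastic matrix of squared moduli of the entries of a unitary matrix. -/
noncomputable def transition (W : Matrix.unitaryGroup (Fin n) ℂ) : Matrix (Fin n) (Fin n) ℝ :=
  Matrix.of fun k i => Complex.normSq (W.1 k i)

lemma transition_mem_doublyStochastic (W : Matrix.unitaryGroup (Fin n) ℂ) :
    transition W ∈ doublyStochastic ℝ (Fin n) := by
  rw [mem_doublyStochastic_iff_sum]
  refine ⟨fun i j => Complex.normSq_nonneg _, fun k => ?_, fun i => ?_⟩
  · have h := congrFun (congrFun (Unitary.coe_mul_star_self W) k) k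
    rw [Matrix.mul_apply, Matrix.one_apply_eq] at h
    rw [← Complex.ofReal_inj, Complex.ofReal_one, ← h, Complex.ofReal_sum]
    refine Finset.sum_congr rfl fun i _ => ?_
    rw [transition, Matrix.of_apply, ← Complex.mul_conj]
    rfl
  · have h := congrFun (congrFun (Unitary.coe_star_mul_self W) i) i
    rw [Matrix.mul_apply, Matrix.one_apply_eq] at h
    rw [← Complex.ofReal_inj, Complex.ofReal_one, ← h, Complex.ofReal_sum]
    refine Finset.sum_congr rfl fun k _ => ?_
    rw [transition, Matrix.of_apply, ← Complex.mul_conj, mul_comm]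
    rfl

/-- Isospectral states have equal norms, so only the overlap `Tr(ρd ρ)` varies. -/
lemma lyapunov_frame_rdiag (W : Matrix.unitaryGroup (Fin n) ℂ) (w : Fin n → ℝ)
    (π : Equiv.Perm (Fin n)) :
    lyapunov (rdiag w) (frame W (rdiag (w ∘ π))) =
      ∑ k, w k ^ 2 - ∑ k, ∑ i, w k * (transition W k i * w (π i)) := by
  set X := frame W (rdiag (w ∘ π)) with hX
  have hXH : X.IsHermitian := (isHermitian_frame_iff W).2 (isHermitian_rdiag _)
  have h1 : (X * X).trace = ((∑ k, w k ^ 2 : ℝ) : ℂ) := by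
    rw [hX, ← map_mul, trace_frame, Matrix.diagonal_mul_diagonal, Matrix.trace_diagonal,
      ← Equiv.sum_comp π fun k => w k ^ 2]
    push_cast
    exact Finset.sum_congr rfl fun k _ => (sq _).symm
  have h2 : (rdiag w * rdiag w).trace = ((∑ k, w k ^ 2 : ℝ) : ℂ) := by
    rw [Matrix.diagonal_mul_diagonal, Matrix.trace_diagonal]
    push_cast
    exact Finset.sum_congr rfl fun k _ => (sq _).symm
  have h3 : (rdiag w * X).trace =
      ((∑ k, ∑ i, w k * (transition W k i * w (π i)) : ℝ) : ℂ) := by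
    rw [Matrix.trace, Complex.ofReal_sum]
    refine Finset.sum_congr rfl fun k _ => ?_
    rw [Matrix.diag_apply, Matrix.diagonal_mul, hX, frame_rdiag_apply, Finset.mul_sum,
      Complex.ofReal_sum]
    refine Finset.sum_congr rfl fun i _ => ?_
    rw [transition, Matrix.of_apply, Complex.ofReal_mul, Complex.ofReal_mul, ← Complex.mul_conj,
      RCLike.star_def]
    simp only [Function.comp_apply]
    ring
  rw [lyapunov, (hXH.sub (isHermitian_rdiag w)).eq, sub_mul, mul_sub, mul_sub, Matrix.trace_sub,
    Matrix.trace_sub, Matrix.trace_sub, Matrix.trace_mul_comm X (rdiag w), h1, h2, h3]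
  simp only [Complex.sub_re, Complex.ofReal_re]
  ring

lemma sum_transition_one (w v : Fin n → ℝ) :
    ∑ k, ∑ i, w k * (transition 1 k i * v i) = ∑ k, w k * v k := by
  refine Finset.sum_congr rfl fun k _ => ?_
  rw [Finset.sum_eq_single k]
  · simp [transition]
  · intro i _ hik
    simp [transition, Matrix.one_apply_ne hik.symm]
  · simp

/-- By Birkhoff the overlap is a convex combination of permutation sums, each at least the reversing
one. At the minimum every `σ` with nonzero coefficient satisfies `π * σ = τ`. -/
lemma frame_eq_of_sum_le {w : Fin n → ℝ} (hw : Function.Injective w)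
    {τ : Equiv.Perm (Fin n)} (hτ : Reverses w τ) (W : Matrix.unitaryGroup (Fin n) ℂ)
    (π : Equiv.Perm (Fin n))
    (h : ∑ k, ∑ i, w k * (transition W k i * w (π i)) ≤ ∑ k, w k * w (τ k)) :
    frame W (rdiag (w ∘ π)) = rdiag (w ∘ τ) := by
  obtain ⟨c, hc0, hc1, hc⟩ :=
    exists_eq_sum_perm_of_mem_doublyStochastic (transition_mem_doublyStochastic W)
  have hentry : ∀ k i, transition W k i = ∑ σ, if σ k = i then c σ else 0 := by
    intro k i
    rw [← hc, Matrix.sum_apply]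
    refine Finset.sum_congr rfl fun σ _ => ?_
    simp [PEquiv.toMatrix_apply, Equiv.toPEquiv_apply]
  have hsum : ∑ k, ∑ i, w k * (transition W k i * w (π i)) =
      ∑ σ, c σ * ∑ k, w k * w ((π * σ) k) := by
    simp only [hentry, Finset.sum_mul, Finset.mul_sum]
    rw [Finset.sum_comm (f := fun σ k => c σ * (w k * w ((π * σ) k)))]
    refine Finset.sum_congr rfl fun k _ => ?_
    rw [Finset.sum_comm]
    refine Finset.sum_congr rfl fun σ _ => ?_
    rw [Finset.sum_eq_single (σ k) (fun i _ hi => by simp [hi.symm]) (by simp), if_pos rfl,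
      Equiv.Perm.mul_apply]
    ring
  have hnonneg : ∀ σ ∈ Finset.univ, 0 ≤ c σ * (∑ k, w k * w ((π * σ) k) - ∑ k, w k * w (τ k)) :=
    fun σ _ => mul_nonneg (hc0 σ) (sub_nonneg.2 (sum_mul_le_of_reverses hw hτ _))
  have hzero : ∑ σ, c σ * (∑ k, w k * w ((π * σ) k) - ∑ k, w k * w (τ k)) = 0 := by
    refine le_antisymm ?_ (Finset.sum_nonneg hnonneg)
    simp only [mul_sub, Finset.sum_sub_distrib]
    rw [← hsum, ← Finset.sum_mul, hc1, one_mul]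
    exact sub_nonpos.2 h
  rw [Finset.sum_eq_zero_iff_of_nonneg hnonneg] at hzero
  -- Row `k` of `W` is thus supported where the eigenvalue is `w (τ k)`, so that eigenvalue factors
  -- out of the matrix entries and leaves `W Wᴴ = 1`.
  have hW : ∀ k i, W.1 k i ≠ 0 → π i = τ k := by
    intro k i hki
    have h1 : transition W k i ≠ 0 := by simpa [transition] using hki
    rw [hentry] at h1
    obtain ⟨σ, hσ, hσ0⟩ := Finset.exists_ne_zero_of_sum_ne_zero h1
    have hki : σ k = i := by
      by_contra hne
      exact hσ0 (if_neg hne)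
    rw [if_pos hki] at hσ0
    have h2 := (mul_eq_zero.1 (hzero σ hσ)).resolve_left hσ0
    rw [← eq_of_sum_mul_eq hw hτ (sub_eq_zero.1 h2), Equiv.Perm.mul_apply, hki]
  refine Matrix.ext fun k l => ?_
  have h1 : frame W (rdiag (w ∘ π)) k l = w (τ k) * (W.1 * star W.1) k l := by
    rw [frame_rdiag_apply, Matrix.mul_apply, Finset.mul_sum]
    refine Finset.sum_congr rfl fun i _ => ?_
    by_cases hki : W.1 k i = 0
    · simp [hki]
    · rw [Function.comp_apply, hW k i hki, Matrix.star_apply]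
      ring
  rw [h1, Unitary.mul_star_self_of_mem W.2, Matrix.one_apply, rdiag_apply]
  simp

lemma lyapunov_lt_of_reverses (U : Matrix.unitaryGroup (Fin n) ℂ) {w : Fin n → ℝ}
    (hw : Function.Injective w) {τ : Equiv.Perm (Fin n)} (hτ : Reverses w τ) {ρ : CMat n}
    (hρ : ρ ∈ stateManifold (frame U (rdiag w))) (hne : ρ ≠ frame U (rdiag (w ∘ τ))) :
    lyapunov (frame U (rdiag w)) ρ < lyapunov (frame U (rdiag w)) (frame U (rdiag (w ∘ τ))) := by
  obtain ⟨W, π, rfl⟩ := exists_frame_rdiag_of_mem_stateManifold U hw hρ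
  have h1 : rdiag (w ∘ τ) = frame 1 (rdiag (w ∘ τ)) := by
    simp [frame_apply]
  rw [lyapunov_frame, lyapunov_frame]
  conv_rhs => rw [h1]
  rw [lyapunov_frame_rdiag, lyapunov_frame_rdiag, sum_transition_one w fun i => w (τ i)]
  refine sub_lt_sub_left (not_le.1 fun hle => hne ?_) _
  rw [frame_eq_of_sum_le hw hτ W π hle]

end Maximum

/-! ### Sinks, sources and saddles from the signs of the weights. -/

section Classification

variable {n : ℕ}

lemma weight_pos_iff {B : CMat n} (hB : FullyConnected B) {v w : Fin n → ℝ} (p : OffDiag n) :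
    0 < weight B v w p ↔ 0 < (v p.1.2 - v p.1.1) * (w p.1.2 - w p.1.1) :=
  mul_pos_iff_of_pos_left (Complex.normSq_pos.2 (hB _ _ p.2))

lemma weight_self_nonneg (B : CMat n) (w : Fin n → ℝ) (p : OffDiag n) : 0 ≤ weight B w w p :=
  mul_nonneg (Complex.normSq_nonneg _) (mul_self_nonneg _)

lemma weight_nonpos_of_reverses (B : CMat n) {w : Fin n → ℝ} {τ : Equiv.Perm (Fin n)}
    (hτ : Reverses w τ) (p : OffDiag n) : weight B (w ∘ τ) w p ≤ 0 := by
  refine mul_nonpos_of_nonneg_of_nonpos (Complex.normSq_nonneg _) ?_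
  simp only [Function.comp_apply]
  rcases lt_trichotomy (w p.1.1) (w p.1.2) with h | h | h
  · exact mul_nonpos_of_nonpos_of_nonneg (sub_nonpos.2 (hτ _ _ h).le) (sub_nonneg.2 h.le)
  · rw [h, sub_self, mul_zero]
  · exact mul_nonpos_of_nonneg_of_nonpos (sub_nonneg.2 (hτ _ _ h).le) (sub_nonpos.2 h.le)

/-- Weights are never zero, so without a negative one all are positive; then `σ` preserves the order
of `w` and is the identity. -/
lemma exists_weight_neg {B : CMat n} (hB : FullyConnected B) {w : Fin n → ℝ}
    (hw : Function.Injective w) {σ : Equiv.Perm (Fin n)} (hσ : σ ≠ 1) :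
    ∃ p, weight B (w ∘ σ) w p < 0 := by
  by_contra! h
  refine hσ (perm_eq_one_of_lt_imp_lt hw fun i j hij => ?_)
  let p : OffDiag n := ⟨(i, j), fun e : i = j => by simp [e] at hij⟩
  have h1 := (weight_pos_iff hB p).1
    ((h p).lt_of_ne (weight_ne_zero hB (hw.comp σ.injective) hw p).symm)
  exact sub_pos.1 (pos_of_mul_pos_left h1 (sub_pos.2 hij).le)

lemma exists_weight_pos {B : CMat n} (hB : FullyConnected B) {w : Fin n → ℝ}
    (hw : Function.Injective w) {σ : Equiv.Perm (Fin n)} (hσ : ¬ Reverses w σ) :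
    ∃ p, 0 < weight B (w ∘ σ) w p := by
  by_contra! h
  refine hσ fun i j hij => ?_
  let p : OffDiag n := ⟨(i, j), fun e : i = j => by simp [e] at hij⟩
  have hij' : i ≠ j := p.2
  refine lt_of_le_of_ne (not_lt.1 fun hlt => (h p).not_gt ((weight_pos_iff hB p).2
    (mul_pos (sub_pos.2 hlt) (sub_pos.2 hij)))) fun e => hij' (σ.injective (hw e)).symm

variable (U : Matrix.unitaryGroup (Fin n) ℂ) {B : CMat n} {a w : Fin n → ℝ}

lemma isHyperbolic_frame_rdiag (hB : B.IsHermitian) (hB' : FullyConnected B)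
    (ha : StronglyRegular a) (hw : Function.Injective w) (σ : Equiv.Perm (Fin n)) :
    IsHyperbolic (frame U (rdiag a)) (frame U B) (frame U (rdiag w))
      (frame U (rdiag (w ∘ σ))) := by
  have hv := hw.comp σ.injective
  refine ⟨leavesInvariant_linearization U hB a w hv, fun z hz => ?_⟩
  rw [isRestrictedEigenvalue_linearization_iff U hB hB' ha hv hw] at hz
  exact re_ne_zero_of_secular_eq_zero hz.2

lemma isSink_frame_rdiag_iff (hB : B.IsHermitian) (hB' : FullyConnected B)
    (ha : StronglyRegular a) (hw : Function.Injective w) (σ : Equiv.Perm (Fin n)) :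
    IsSink (frame U (rdiag a)) (frame U B) (frame U (rdiag w)) (frame U (rdiag (w ∘ σ))) ↔
      σ = 1 := by
  have hv := hw.comp σ.injective
  constructor
  · rintro ⟨hT, h⟩
    by_contra hσ
    obtain ⟨p, hp⟩ := exists_weight_neg hB' hw hσ
    obtain ⟨z, hz, h0, hre⟩ := exists_secular_eq_zero_re_pos (freq_injective ha)
      (weight_ne_zero hB' hv hw) hp
    exact (h z ((isRestrictedEigenvalue_linearization_iff U hB hB' ha hv hw hT z).2
      ⟨hz, h0⟩)).not_gt hre
  · rintro rfl
    refine ⟨leavesInvariant_linearization U hB a w hv, fun z hz => ?_⟩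
    rw [isRestrictedEigenvalue_linearization_iff U hB hB' ha hv hw] at hz
    exact re_neg_of_secular_eq_zero (weight_self_nonneg B w) hz.2

lemma isSource_frame_rdiag (hB : B.IsHermitian) (hB' : FullyConnected B)
    (ha : StronglyRegular a) (hw : Function.Injective w) {τ : Equiv.Perm (Fin n)}
    (hτ : Reverses w τ) :
    IsSource (frame U (rdiag a)) (frame U B) (frame U (rdiag w)) (frame U (rdiag (w ∘ τ))) := by
  have hv := hw.comp τ.injective
  refine ⟨leavesInvariant_linearization U hB a w hv, fun z hz => ?_⟩
  rw [isRestrictedEigenvalue_linearization_iff U hB hB' ha hv hw] at hz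
  exact re_pos_of_secular_eq_zero (weight_nonpos_of_reverses B hτ) hz.2

lemma isSaddle_frame_rdiag (hB : B.IsHermitian) (hB' : FullyConnected B)
    (ha : StronglyRegular a) (hw : Function.Injective w) {σ : Equiv.Perm (Fin n)}
    (hσ : σ ≠ 1) (hσ' : ¬ Reverses w σ) :
    IsSaddle (frame U (rdiag a)) (frame U B) (frame U (rdiag w)) (frame U (rdiag (w ∘ σ))) := by
  have hv := hw.comp σ.injective
  obtain ⟨hT, h⟩ := isHyperbolic_frame_rdiag U hB hB' ha hw σ
  have heig := isRestrictedEigenvalue_linearization_iff U hB hB' ha hv hw hT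
  obtain ⟨p, hp⟩ := exists_weight_neg hB' hw hσ
  obtain ⟨q, hq⟩ := exists_weight_pos hB' hw hσ'
  obtain ⟨z, hz, hz0, hzre⟩ := exists_secular_eq_zero_re_neg (freq_injective ha)
    (weight_ne_zero hB' hv hw) hq
  obtain ⟨y, hy, hy0, hyre⟩ := exists_secular_eq_zero_re_pos (freq_injective ha)
    (weight_ne_zero hB' hv hw) hp
  exact ⟨hT, h, ⟨z, (heig z).2 ⟨hz, hz0⟩, hzre⟩, ⟨y, (heig y).2 ⟨hy, hy0⟩, hyre⟩⟩

lemma not_reverses_one (hn : 2 ≤ n) (hw : Function.Injective w) : ¬ Reverses w 1 := by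
  intro h
  have h01 : w ⟨0, by omega⟩ ≠ w ⟨1, by omega⟩ := fun e => by simpa using hw e
  rcases lt_or_gt_of_ne h01 with h1 | h1
  · exact (h _ _ h1).not_gt h1
  · exact (h _ _ h1).not_gt h1

end Classification

end LyapunovControl

/-! ### Assembly in the eigenbasis of `H₀`. -/

theorem mainTheorem1 (n : ℕ) (hn : 2 ≤ n) (H₀ H₁ ρd : CMat n)
    (hH₀ : H₀.IsHermitian) (hH₁ : H₁.IsHermitian)
    (hideal : LyapunovControl.IsIdeal H₀ H₁)
    (hρd : LyapunovControl.IsDensity ρd) (hgen : LyapunovControl.IsGeneric ρd)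
    (hstat : ⁅H₀, ρd⁆ = 0) :
    -- there are exactly `n!` stationary states, and all of them are hyperbolic
    (LyapunovControl.stationaryStates H₀ H₁ ρd).encard = ((n !) : ℕ∞) ∧
    (∀ ρ ∈ LyapunovControl.stationaryStates H₀ H₁ ρd,
      LyapunovControl.IsHyperbolic H₀ H₁ ρd ρ) ∧
    -- `ρd` is a stationary state and the only sink
    ρd ∈ LyapunovControl.stationaryStates H₀ H₁ ρd ∧
    (∀ ρ ∈ LyapunovControl.stationaryStates H₀ H₁ ρd,
      LyapunovControl.IsSink H₀ H₁ ρd ρ ↔ ρ = ρd) ∧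
    -- the unique global maximum `ρm` of `V` on the manifold is a stationary state and a source
    ∃ ρm ∈ LyapunovControl.stationaryStates H₀ H₁ ρd,
      (∀ ρ ∈ LyapunovControl.stateManifold ρd, ρ ≠ ρm →
        LyapunovControl.lyapunov ρd ρ < LyapunovControl.lyapunov ρd ρm) ∧
      ρm ≠ ρd ∧
      LyapunovControl.IsSource H₀ H₁ ρd ρm ∧
      -- all other stationary states are saddles, and there are `n! - 2` of them
      (∀ ρ ∈ LyapunovControl.stationaryStates H₀ H₁ ρd, ρ ≠ ρd → ρ ≠ ρm →
        LyapunovControl.IsSaddle H₀ H₁ ρd ρ) ∧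
      (LyapunovControl.stationaryStates H₀ H₁ ρd \ {ρd, ρm}).encard = (((n !) - 2 : ℕ) : ℕ∞) := by
  open LyapunovControl in
  obtain ⟨U, hU, a, hH₀a, ha, hconn⟩ := hideal
  lift U to Matrix.unitaryGroup (Fin n) ℂ using hU
  obtain ⟨B, rfl⟩ := frame_surjective U H₁
  have hBU : (U : CMat n)ᴴ * frame U B * (U : CMat n) = B := (frame U).symm_apply_apply B
  rw [hBU] at hconn
  have hB := (isHermitian_frame_iff U).1 hH₁
  obtain rfl : H₀ = frame U (rdiag a) := hH₀a
  obtain ⟨D, rfl⟩ := frame_surjective U ρd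
  obtain ⟨w, rfl⟩ : ∃ w, D = rdiag w := by
    refine eq_rdiag_of_flowLin_eq_zero ha.injective
      ((isHermitian_frame_iff U).1 hρd.1.isHermitian) ?_
    rw [← map_eq_zero_iff _ (frame_injective U), ← flowLin_frame, flowLin_apply, hstat, smul_zero]
  have hw := injective_of_isGeneric U hgen
  obtain ⟨τ, hτ⟩ := exists_reverses hw
  have hmem := fun ρ => mem_stationaryStates_iff U (B := B) (ρ := ρ) ha.injective hw hρd
  have hinj := frame_rdiag_comp_injective U hw
  have hd : ∀ σ : Equiv.Perm (Fin n),
      -- The target state is the one of `σ = 1`, since `w ∘ 1` is `w` by definition.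
      frame U (rdiag (w ∘ σ)) = frame U (rdiag w) ↔ σ = 1 := fun σ => hinj.eq_iff (b := 1)
  have hm : ∀ σ : Equiv.Perm (Fin n),
      frame U (rdiag (w ∘ σ)) = frame U (rdiag (w ∘ τ)) ↔ σ = τ := fun σ => hinj.eq_iff
  have hcard := encard_stationaryStates U (B := B) ha.injective hw hρd
  have hdmem := (hmem (frame U (rdiag w))).2 ⟨1, rfl⟩
  have hτ1 : frame U (rdiag (w ∘ τ)) ≠ frame U (rdiag w) := by
    rw [Ne, hd]
    rintro rfl
    exact not_reverses_one hn hw hτ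
  refine ⟨hcard, ?_, hdmem, ?_, frame U (rdiag (w ∘ τ)), (hmem _).2 ⟨τ, rfl⟩,
    fun ρ hρ hne => lyapunov_lt_of_reverses U hw hτ hρ hne, hτ1,
    isSource_frame_rdiag U hB hconn ha hw hτ, ?_, ?_⟩
  · intro ρ hρ
    obtain ⟨σ, rfl⟩ := (hmem ρ).1 hρ
    exact isHyperbolic_frame_rdiag U hB hconn ha hw σ
  · intro ρ hρ
    obtain ⟨σ, rfl⟩ := (hmem ρ).1 hρ
    rw [isSink_frame_rdiag_iff U hB hconn ha hw, hd]
  · intro ρ hρ h1 h2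
    obtain ⟨σ, rfl⟩ := (hmem ρ).1 hρ
    rw [Ne, hd] at h1
    rw [Ne, hm] at h2
    exact isSaddle_frame_rdiag U hB hconn ha hw h1 fun h => h2 (h.eq hw hτ)
  · rw [Set.encard_sdiff (by
      rintro ρ (rfl | rfl)
      · exact hdmem
      · exact (hmem _).2 ⟨τ, rfl⟩) (Set.toFinite _), hcard, Set.encard_pair hτ1.symm]
    norm_cast
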